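/- Let $n\equiv 0 \pmod 3$. The $n$-vertex nested triangles graph has vertices $v_1,\dots,v_n$ and consists of the triangles $v_{i-2}v_{i-1}v_i$ for $i=3,6,\dots,n$ and the edges $v_iv_{i+3}$ for $i=1,\dots,n-3$. A graph story $\langle G,\tau,W\rangle$ is a finite graph $G=(V,E)$ with a bijection $\tau:V\to\{1,\dots,|V|\}$ and a window size $W\in\mathbb N$; at time $t\in\{1,\dots,|V|+W-1\}$ the graph $G_t$ is the subgraph of $G$ induced by $\{v\in V: t-W<\tau(v)\le t\}$. It is a planar graph story if $G$ is planar. A planar straight-line grid drawing story is a sequence of planar straight-line drawings $\Gamma_t$ of the graphs $G_t$, with vertices at points with integer coordinates, in which each vertex has the same position in all the drawings where it appears. A drawing lies on a $w\times h$ grid if it is contained in $[a,b]\times[c,d]$ for some integers $a<b$, $c<d$ with $b-a+1=w$ and $d-c+1=h$; a drawing story lies on a $w\times h$ grid if each of its drawings does (the position of the grid may depend on $t$). (1) There is a constant $c>0$ such that the following holds for every $n\equiv 0\pmod 3$. Let $G$ be the $n$-vertex nested triangles graph and $\tau(v_i)=i$. Then $\langle G,\tau,9\rangle$ is a planar graph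 story, and whenever a planar straight-line grid drawing story of $\langle G,\tau,9\rangle$ lies on a $w\times h$ grid, $w\ge cn$ and $h\ge cn$. That is, every such drawing story requires an $\Omega(n)\times\Omega(n)$ grid. (2) Consequently, the area of drawing stories of planar graph stories cannot be bounded by a function of $W$ alone: for every function $f:\mathbb N\to\mathbb N$ there is a planar graph story $\langle G,\tau,W\rangle$ that has planar straight-line grid drawing stories, and such that each of them contains a drawing $\Gamma_t$ that lies on no $w\times h$ grid with $w\cdot h\le f(W)$. -/

import Mathlib

/-- A Jordan arc between two points of the plane: the image of an injective continuous path. -/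
def IsJordanArc (p q : ℝ × ℝ) (A : Set (ℝ × ℝ)) : Prop :=
  ∃ γ : Path p q, Function.Injective γ ∧ Set.range γ = A

/-- A drawing of a graph maps the vertices to distinct points of the plane, and each edge to a
Jordan arc between its end-points. (The values of `arc` off the edge set carry no meaning.) -/
structure Drawing {V : Type} (G : SimpleGraph V) where
  pos : V → ℝ × ℝ
  arc : Sym2 V → Set (ℝ × ℝ)
  pos_injective : Function.Injective pos
  isJordanArc : ∀ u v : V, G.Adj u v → IsJordanArc (pos u) (pos v) (arc s(u, v))

namespace Drawing

variable {V : Type} {G : SimpleGraph V}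

/-- Every edge is drawn as a straight-line segment. -/
def IsStraightLine (D : Drawing G) : Prop :=
  ∀ u v : V, G.Adj u v → D.arc s(u, v) = segment ℝ (D.pos u) (D.pos v)

/-- No two arcs intersect, except at a common end-point. -/
def IsPlanar (D : Drawing G) : Prop :=
  ∀ e ∈ G.edgeSet, ∀ f ∈ G.edgeSet, e ≠ f →
    D.arc e ∩ D.arc f ⊆ D.pos '' {v | v ∈ e ∧ v ∈ f}

/-- Every vertex has integer coordinates. -/
def IsOnGrid (D : Drawing G) : Prop :=
  ∀ v : V, ∃ x y : ℤ, D.pos v = ((x : ℝ), (y : ℝ))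

/-- The set of points of the plane covered by the drawing. -/
def carrier (D : Drawing G) : Set (ℝ × ℝ) :=
  Set.range D.pos ∪ ⋃ e ∈ G.edgeSet, D.arc e

/-- The drawing lies on a `w × h` grid: it is enclosed by the bounding box of some integer grid
`[a,b] × [c,d]` with `a < b` and `c < d`, having `w = b - a + 1` columns and `h = d - c + 1`
rows. -/
def LiesOn (D : Drawing G) (w h : ℕ) : Prop :=
  ∃ a b c d : ℤ, a < b ∧ c < d ∧ b - a + 1 = (w : ℤ) ∧ d - c + 1 = (h : ℤ) ∧
    D.carrier ⊆ Set.Icc (a : ℝ) (b : ℝ) ×ˢ Set.Icc (c : ℝ) (d : ℝ)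

end Drawing

/-- A graph is planar if it has a planar drawing. -/
def IsPlanarGraph {V : Type} (G : SimpleGraph V) : Prop :=
  ∃ D : Drawing G, D.IsPlanar

/-- A graph story `⟨G, τ, W⟩`: a finite graph `G` whose vertices appear at the distinct times
`1, …, |V|` given by `τ`, and a window size `W`. -/
structure GraphStory (V : Type) [Fintype V] where
  graph : SimpleGraph V
  τ : V → ℕ
  bijOn_τ : Set.BijOn τ Set.univ (Set.Icc 1 (Fintype.card V))
  W : ℕ

namespace GraphStory

variable {V : Type} [Fintype V]

/-- The vertices `v` present at time `t`, that is, with `t - W < τ v ≤ t`. -/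
def present (S : GraphStory V) (t : ℕ) : Set V :=
  {v | t < S.τ v + S.W ∧ S.τ v ≤ t}

/-- The graph `G_t`, induced by the vertices present at time `t`. -/
def graphAt (S : GraphStory V) (t : ℕ) : SimpleGraph (S.present t) :=
  S.graph.induce (S.present t)

/-- The times `1, …, n + W - 1` of the story, where `n` is the number of vertices. -/
abbrev Time (S : GraphStory V) : Type :=
  Set.Icc 1 (Fintype.card V + S.W - 1)

/-- The story of a planar graph. -/
def IsPlanar (S : GraphStory V) : Prop :=
  IsPlanarGraph S.graph

end GraphStory

/-- A drawing story: one drawing of each graph `G_t`, where each vertex keeps its position and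
each edge keeps its curve in all the drawings in which it appears. -/
structure DrawingStory {V : Type} [Fintype V] (S : GraphStory V) where
  drawing : ∀ t : S.Time, Drawing (S.graphAt t)
  pos_eq : ∀ (s t : S.Time) (v : V) (hs : v ∈ S.present s) (ht : v ∈ S.present t),
    (drawing s).pos ⟨v, hs⟩ = (drawing t).pos ⟨v, ht⟩
  arc_eq : ∀ (s t : S.Time) (u v : V) (hus : u ∈ S.present s) (hvs : v ∈ S.present s)
    (hut : u ∈ S.present t) (hvt : v ∈ S.present t), S.graph.Adj u v →
    (drawing s).arc s(⟨u, hus⟩, ⟨v, hvs⟩) = (drawing t).arc s(⟨u, hut⟩, ⟨v, hvt⟩)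

namespace DrawingStory

variable {V : Type} [Fintype V] {S : GraphStory V}

/-- All drawings of the story are planar, straight-line and on the grid. -/
def IsPlanarStraightLineGrid (Γ : DrawingStory S) : Prop :=
  ∀ t : S.Time, (Γ.drawing t).IsPlanar ∧ (Γ.drawing t).IsStraightLine ∧ (Γ.drawing t).IsOnGrid

/-- All drawings of the story lie on a `w × h` grid (the grid may be translated over time). -/
def LiesOn (Γ : DrawingStory S) (w h : ℕ) : Prop :=
  ∀ t : S.Time, (Γ.drawing t).LiesOn w h

end DrawingStory

/-- The nested triangles graph on the vertices `v_1, …, v_n` (for `n` divisible by `3`), where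
`v_i` is the element `i - 1` of `Fin n`: the triangles `v_{3k+1} v_{3k+2} v_{3k+3}` together with
the edges `v_i v_{i+3}`. -/
def nestedTriangles (n : ℕ) : SimpleGraph (Fin n) :=
  SimpleGraph.fromRel fun i j => (i : ℕ) / 3 = (j : ℕ) / 3 ∨ (i : ℕ) + 3 = (j : ℕ)

/-- The story of the nested triangles graph with `τ(v_i) = i` and window size `9`. -/
def nestedTrianglesStory (n : ℕ) : GraphStory (Fin n) where
  graph := nestedTriangles n
  τ := fun i => (i : ℕ) + 1
  bijOn_τ := by
    refine ⟨fun i _ => ?_, fun i _ j _ h => ?_, fun k hk => ?_⟩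
    · have := i.isLt
      simp only [Fintype.card_fin, Set.mem_Icc]
      omega
    · have h' : (i : ℕ) + 1 = (j : ℕ) + 1 := h
      exact Fin.ext (by omega)
    · simp only [Fintype.card_fin, Set.mem_Icc] at hk
      refine ⟨⟨k - 1, by omega⟩, Set.mem_univ _, ?_⟩
      show k - 1 + 1 = k
      omega
  W := 9

/-! With window size 9, any three consecutive triangles `p`, `v`, `q` of the nested triangles graph
are at some moment drawn together, with the spokes that join them. The geometric core,
`IsTriangleStack.mem_hull`, says that `p` and `q` cannot both lie outside `v`. So along the sequence
each triangle lies inside the next one up to some index, and from then on each triangle contains its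
successor (`exists_hasExtent`). On the integer grid, containment with disjoint boundaries adds at
least 1 at each of the four extremes, so width and height grow by at least 2 per step
(`AreNestable.hasExtent`). One of the two triangles at the turning point therefore spans linearly
many columns and rows, and it fits into a single drawing.

The core is a winding number argument. Suppose that `p` and `q` are both outside `v`. The
quadrilaterals with corners `v i`, `p i`, `p (i + 1)`, `v (i + 1)` add up to the cycle `p - v`. The
quadrilateral over side `i` winds equally around `q` and around the centroid of `v`, because both
are connected to `v (i + 2)` without meeting it. The polygon `p` also winds equally around both,
hence so does `v`. But `v` has winding 0 around the outside point and nonzero winding around its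
centroid.

Planarity, and the existence of at least one grid drawing story, come from an explicit concentric
drawing. The second claim then follows because the window stays 9 while the number of vertices is
arbitrary. -/

/-! ### Winding numbers of closed polygons -/

/-- The oriented angle at `p` swept by a point that runs along the segment from `u` to `v`. -/
noncomputable def turn (p u v : ℂ) : ℝ := ((v - p) / (u - p)).arg

/-- The quotient is a nonpositive real exactly when `p` separates `u` from `v` on a line or equals
`v`; off the segment, `arg` is thus continuous and never `π`. -/
theorem ratio_mem_slitPlane {p u v : ℂ} (h : p ∉ segment ℝ u v) :
    (v - p) / (u - p) ∈ Complex.slitPlane := by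
  have hu : u - p ≠ 0 := fun h0 => h (by
    rw [← sub_eq_zero.1 h0]; exact left_mem_segment ℝ u v)
  rw [Complex.mem_slitPlane_iff_not_le_zero]
  intro hle
  obtain ⟨hre, him⟩ := Complex.le_def.1 hle
  set t : ℝ := -((v - p) / (u - p)).re with ht
  have ht0 : 0 ≤ t := by simp only [Complex.zero_re] at hre; linarith
  have hz : (v - p) / (u - p) = ((-t : ℝ) : ℂ) := by
    apply Complex.ext
    · simp [ht]
    · simpa using him
  have hv : v - p = ((-t : ℝ) : ℂ) * (u - p) := by rw [← hz, div_mul_cancel₀ _ hu]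
  have h1 : (0 : ℝ) < 1 + t := by linarith
  have h1c : (1 + (t : ℂ)) ≠ 0 := by exact_mod_cast h1.ne'
  -- Solving `v - p = -t (u - p)` for `p` gives these weights.
  refine h ⟨t / (1 + t), 1 / (1 + t), by positivity, by positivity, by field_simp; ring, ?_⟩
  simp only [Complex.real_smul]
  push_cast at hv ⊢
  field_simp
  linear_combination hv

theorem continuousOn_turn (u v : ℂ) :
    ContinuousOn (fun p => turn p u v) (segment ℝ u v)ᶜ := by
  intro p hp
  apply ContinuousAt.continuousWithinAt
  have hu : u - p ≠ 0 := fun h0 => hp (by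
    rw [← sub_eq_zero.1 h0]; exact left_mem_segment ℝ u v)
  have h2 : ContinuousAt (fun p : ℂ => (v - p) / (u - p)) p :=
    ContinuousAt.div (by fun_prop) (by fun_prop) hu
  exact ContinuousAt.comp (g := Complex.arg) (Complex.continuousAt_arg (ratio_mem_slitPlane hp)) h2

theorem turn_swap {p u v : ℂ} (h : p ∉ segment ℝ u v) : turn p v u = -turn p u v := by
  unfold turn
  rw [← inv_div, Complex.arg_inv, if_neg (Complex.mem_slitPlane_iff_arg.1 (ratio_mem_slitPlane h)).1]

/-- The total angle swept around `p` by the closed polygon with vertices `v 0, v 1, …`. -/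
noncomputable def winding {k : ℕ} [NeZero k] (v : Fin k → ℂ) (p : ℂ) : ℝ :=
  ∑ i, turn p (v i) (v (i + 1))

section Winding

variable {k : ℕ} [NeZero k] {v : Fin k → ℂ}

/-- Exponentiating the angle sum gives a cyclic product of quotients of unit vectors, which
telescopes to 1. -/
theorem winding_mem_range {p : ℂ} (h : ∀ i, v i ≠ p) :
    winding v p ∈ Set.range fun m : ℤ => (m : ℝ) * (2 * Real.pi) := by
  have h1 : ∀ i, v i - p ≠ 0 := fun i => sub_ne_zero.2 (h i)
  have h2 : Complex.exp ((winding v p : ℝ) * Complex.I) = 1 := by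
    unfold winding
    rw [Complex.ofReal_sum, Finset.sum_mul, Complex.exp_sum]
    have h3 : ∀ i, Complex.exp ((turn p (v i) (v (i + 1)) : ℝ) * Complex.I)
        = ((v (i + 1) - p) / (‖v (i + 1) - p‖ : ℂ)) / ((v i - p) / (‖v i - p‖ : ℂ)) := by
      intro i
      unfold turn
      have hz : ∀ z : ℂ, z ≠ 0 → Complex.exp (z.arg * Complex.I) = z / ‖z‖ := by
        intro z hz
        rw [eq_div_iff (by simpa using hz), mul_comm]
        exact Complex.norm_mul_exp_arg_mul_I z
      rw [hz _ (div_ne_zero (h1 _) (h1 _)), norm_div, Complex.ofReal_div, div_div_div_comm]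
    simp only [h3]
    have h4 := Equiv.prod_comp (Equiv.addRight (1 : Fin k))
      (fun i => (v i - p) / (‖v i - p‖ : ℂ))
    simp only [Equiv.coe_addRight] at h4
    rw [Finset.prod_div_distrib, h4]
    apply div_self
    refine Finset.prod_ne_zero_iff.2 fun i _ => div_ne_zero (h1 i) ?_
    simpa using h1 i
  obtain ⟨m, hm⟩ := Complex.exp_eq_one_iff.1 h2
  refine ⟨m, ?_⟩
  have := congrArg Complex.im hm
  simp at this
  simp [this]

/-- The winding is continuous off the polygon and takes values in a discrete set, so it is constant
on a connected set that misses the polygon. -/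
theorem winding_eq_of_disjoint {x y : ℂ}
    (h : ∀ i, Disjoint (segment ℝ x y) (segment ℝ (v i) (v (i + 1)))) :
    winding v x = winding v y := by
  have hc : ContinuousOn (winding v) (segment ℝ x y) := by
    unfold winding
    refine continuousOn_finsetSum _ fun i _ => (continuousOn_turn _ _).mono fun z hz hz' => ?_
    exact Set.disjoint_left.1 (h i) hz hz'
  have hm : Set.MapsTo (fun z => winding v z / (2 * Real.pi)) (segment ℝ x y)
      (Set.range ((↑) : ℤ → ℝ)) := by
    intro z hz
    obtain ⟨m, hm⟩ := winding_mem_range (v := v) (p := z) fun i hi =>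
      Set.disjoint_left.1 (h i) hz (hi ▸ left_mem_segment ℝ _ _)
    refine ⟨m, ?_⟩
    simp only [← hm]
    field_simp
  have hd : IsDiscrete (Set.range ((↑) : ℤ → ℝ)) := by
    refine ⟨?_⟩
    exact Int.isClosedEmbedding_coe_real.isEmbedding.toHomeomorph.symm.isEmbedding.discreteTopology
  have := (convex_segment x y).isPreconnected.constant_of_mapsTo
    (T := Set.range ((↑) : ℤ → ℝ)) hd (hc.div_const _) hm
    (left_mem_segment ℝ x y) (right_mem_segment ℝ x y)
  field_simp at this
  exact this

/-- A separating line puts all directions from `p` to the vertices into one open half-plane. There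
each turn is a difference of arguments, and the cyclic sum telescopes. -/
theorem winding_eq_zero {p : ℂ} (h : p ∉ convexHull ℝ (Set.range v)) : winding v p = 0 := by
  have hcl : IsClosed (convexHull ℝ (Set.range v)) := (Set.finite_range v).isClosed_convexHull ℝ
  obtain ⟨f, s, hfp, hfs⟩ := geometric_hahn_banach_point_closed (convex_convexHull ℝ _) hcl h
  -- Multiplication by `u` rotates the half-plane where `f` is positive onto the right half-plane.
  set u : ℂ := ⟨f 1, -f Complex.I⟩ with hu
  have hf : ∀ z : ℂ, f z = (z * u).re := by
    intro z
    have : z = z.re • (1 : ℂ) + z.im • Complex.I := by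
      apply Complex.ext <;> simp
    conv_lhs => rw [this, map_add, map_smul, map_smul]
    simp [hu]
  have hpos : ∀ i, 0 < ((v i - p) * u).re := by
    intro i
    rw [← hf, map_sub]
    linarith [hfs (v i) (subset_convexHull ℝ _ ⟨i, rfl⟩)]
  have hu0 : u ≠ 0 := by
    intro h0
    have := hpos 0
    simp [h0] at this
  have ht : ∀ i, turn p (v i) (v (i + 1))
      = ((v (i + 1) - p) * u).arg - ((v i - p) * u).arg := by
    intro i
    have e : (v (i + 1) - p) / (v i - p) = ((v (i + 1) - p) * u) / ((v i - p) * u) := by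
      rw [mul_div_mul_right _ _ hu0]
    have hx := hpos i
    have hy := hpos (i + 1)
    unfold turn
    have ax := abs_lt.1 (Complex.abs_arg_lt_pi_div_two_iff.2 (Or.inl hx))
    have ay := abs_lt.1 (Complex.abs_arg_lt_pi_div_two_iff.2 (Or.inl hy))
    have hx0 : (v i - p) * u ≠ 0 := fun h0 => by simp [h0] at hx
    have hy0 : (v (i + 1) - p) * u ≠ 0 := fun h0 => by simp [h0] at hy
    have hinv : ((v i - p) * u)⁻¹.arg = -((v i - p) * u).arg := by
      rw [Complex.arg_inv, if_neg (by linarith [Real.pi_pos])]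
    have hI : ((v (i + 1) - p) * u).arg + ((v i - p) * u)⁻¹.arg
        ∈ Set.Ioc (-Real.pi) Real.pi := by
      rw [hinv]
      constructor <;> linarith
    rw [e, div_eq_mul_inv, Complex.arg_mul hy0 (inv_ne_zero hx0) hI, hinv]
    ring
  unfold winding
  simp only [ht]
  rw [Finset.sum_sub_distrib, sub_eq_zero]
  exact Equiv.sum_comp (Equiv.addRight (1 : Fin k)) (fun i => ((v i - p) * u).arg)

end Winding

/-! ### Points inside and outside a triangle -/

theorem mem_convexHull_range_three {E : Type*} [AddCommGroup E] [Module ℝ E] {v : Fin 3 → E}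
    {p : E} : p ∈ convexHull ℝ (Set.range v) ↔
      ∃ w : Fin 3 → ℝ, (∀ i, 0 ≤ w i) ∧ ∑ i, w i = 1 ∧ ∑ i, w i • v i = p := by
  constructor
  · intro h
    have hsub : convexHull ℝ (Set.range v) ⊆
        {p | ∃ w : Fin 3 → ℝ, (∀ i, 0 ≤ w i) ∧ ∑ i, w i = 1 ∧ ∑ i, w i • v i = p} := by
      apply convexHull_min
      · rintro _ ⟨i, rfl⟩
        refine ⟨Pi.single i 1, fun j => ?_, by simp, ?_⟩
        · by_cases hj : j = i
          · subst hj; simp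
          · simp [Pi.single_eq_of_ne hj]
        · simp [Pi.single_apply]
      · rintro _ ⟨w, hw, hw1, rfl⟩ _ ⟨w', hw', hw1', rfl⟩ a b ha hb hab
        refine ⟨fun i => a * w i + b * w' i, fun i => ?_, ?_, ?_⟩
        · have := hw i
          have := hw' i
          positivity
        · rw [Finset.sum_add_distrib, ← Finset.mul_sum, ← Finset.mul_sum, hw1, hw1']
          linarith
        · simp only [add_smul, mul_smul, Finset.sum_add_distrib, Finset.smul_sum]
    exact hsub h
  · rintro ⟨w, hw, hw1, rfl⟩
    exact (convex_convexHull ℝ _).sum_mem (fun i _ => hw i) hw1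
      fun i _ => subset_convexHull ℝ _ ⟨i, rfl⟩

/-- Off the boundary, the barycentric coordinates of a point of a triangle are positive. -/
theorem exists_pos_weights {E : Type*} [AddCommGroup E] [Module ℝ E] {v : Fin 3 → E} {p : E}
    (hp : p ∈ convexHull ℝ (Set.range v)) (hb : ∀ i, p ∉ segment ℝ (v i) (v (i + 1))) :
    ∃ w : Fin 3 → ℝ, (∀ i, 0 < w i) ∧ ∑ i, w i = 1 ∧ ∑ i, w i • v i = p := by
  obtain ⟨w, hw, hw1, hwp⟩ := mem_convexHull_range_three.1 hp
  refine ⟨w, fun i => (hw i).lt_of_ne' fun h0 => ?_, hw1, hwp⟩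
  refine hb (i + 1) ⟨w (i + 1), w (i + 1 + 1), hw _, hw _, ?_, ?_⟩
  · fin_cases i <;> simp_all [Fin.sum_univ_three]
    linarith
  · fin_cases i
    all_goals simp_all [Fin.sum_univ_three]
    rw [add_comm, hwp]

theorem arg_pos_of_im_pos {z : ℂ} (h : 0 < z.im) : 0 < z.arg := by
  refine lt_of_le_of_ne (Complex.arg_nonneg_iff.2 h.le) fun h0 => ?_
  exact h.ne' (Complex.arg_eq_zero_iff.1 h0.symm).2

/-- Crossing the relation `∑ w i • (v i - p) = 0` with the vectors themselves shows that the three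
consecutive cross products have the same sign, so the three turns do too and cannot cancel. If all
vanish, the vectors are positive multiples of one another, contradicting the relation. -/
theorem winding_ne_zero {v : Fin 3 → ℂ} {p : ℂ} (hp : p ∈ convexHull ℝ (Set.range v))
    (hb : ∀ i, p ∉ segment ℝ (v i) (v (i + 1))) : winding v p ≠ 0 := by
  obtain ⟨w, hw, hw1, hwp⟩ := exists_pos_weights hp hb
  have hx : ∀ i, v i - p ≠ 0 := fun i h0 => hb i (by
    rw [← sub_eq_zero.1 h0]; exact left_mem_segment ℝ _ _)
  have hs : ∀ i, (v (i + 1) - p) / (v i - p) ∈ Complex.slitPlane :=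
    fun i => ratio_mem_slitPlane (hb i)
  have h0 : w 0 • (v 0 - p) + w 1 • (v 1 - p) + w 2 • (v 2 - p) = 0 := by
    rw [Fin.sum_univ_three] at hw1 hwp
    have : w 0 • p + w 1 • p + w 2 • p = p := by rw [← add_smul, ← add_smul, hw1, one_smul]
    rw [smul_sub, smul_sub, smul_sub]
    linear_combination (exp := 1) hwp - this
  have him : ∀ i, ((v (i + 1) - p) / (v i - p)).im * Complex.normSq (v i - p)
      = (v i - p).re * (v (i + 1) - p).im - (v i - p).im * (v (i + 1) - p).re := by
    intro i
    have := Complex.normSq_pos.2 (hx i)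
    rw [Complex.div_im]
    field_simp
  have hn : ∀ i, 0 < Complex.normSq (v i - p) := fun i => Complex.normSq_pos.2 (hx i)
  unfold winding turn
  rw [Fin.sum_univ_three]
  have i0 := him 0
  have i1 := him 1
  have i2 := him 2
  have n0 := hn 0
  have n1 := hn 1
  have n2 := hn 2
  have w0 := hw 0
  have w1 := hw 1
  have w2 := hw 2
  have s0 := hs 0
  have s1 := hs 1
  have s2 := hs 2
  have hx0 := hx 0
  have hx1 := hx 1
  simp only [Fin.isValue, zero_add, show (1 : Fin 3) + 1 = 2 from rfl,
    show (2 : Fin 3) + 1 = 0 from rfl] at *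
  generalize v 0 - p = x at *
  generalize v 1 - p = y at *
  generalize v 2 - p = z at *
  have hre := congrArg Complex.re h0
  have hm := congrArg Complex.im h0
  simp only [Complex.add_re, Complex.add_im, Complex.smul_re, Complex.smul_im, smul_eq_mul,
    Complex.zero_re, Complex.zero_im] at hre hm
  have e1 : w 1 * (x.re * y.im - x.im * y.re) = w 2 * (z.re * x.im - z.im * x.re) := by
    linear_combination x.re * hm - x.im * hre
  have e2 : w 0 * (x.re * y.im - x.im * y.re) = w 2 * (y.re * z.im - y.im * z.re) := by
    linear_combination -y.re * hm + y.im * hre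
  rw [← i0] at e1 e2
  rw [← i1] at e2
  rw [← i2] at e1
  rcases lt_trichotomy (y / x).im 0 with h | h | h
  · have a1 : (z / y).im < 0 := by
      by_contra! hc
      have : 0 ≤ w 2 * ((z / y).im * Complex.normSq y) := by positivity
      have : w 0 * ((y / x).im * Complex.normSq x) < 0 :=
        mul_neg_of_pos_of_neg w0 (mul_neg_of_neg_of_pos h n0)
      linarith
    have a2 : (x / z).im < 0 := by
      by_contra! hc
      have : 0 ≤ w 2 * ((x / z).im * Complex.normSq z) := by positivity
      have : w 1 * ((y / x).im * Complex.normSq x) < 0 :=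
        mul_neg_of_pos_of_neg w1 (mul_neg_of_neg_of_pos h n0)
      linarith
    have := Complex.arg_neg_iff.2 h
    have := Complex.arg_neg_iff.2 a1
    have := Complex.arg_neg_iff.2 a2
    linarith
  · have a1 : (z / y).im = 0 := by
      rw [h] at e2
      have := e2.symm
      simpa [w2.ne', n1.ne'] using this
    have r0 : 0 < (y / x).re := by
      rcases Complex.mem_slitPlane_iff.1 s0 with h' | h'
      · exact h'
      · exact absurd h h'
    have r1 : 0 < (z / y).re := by
      rcases Complex.mem_slitPlane_iff.1 s1 with h' | h'
      · exact h'
      · exact absurd a1 h'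
    have hy : y = ((y / x).re : ℂ) * x := by
      rw [show (((y / x).re : ℝ) : ℂ) = y / x from Complex.ext (by simp) (by simp [h]),
        div_mul_cancel₀ _ hx0]
    have hz : z = ((z / y).re : ℂ) * y := by
      rw [show (((z / y).re : ℝ) : ℂ) = z / y from Complex.ext (by simp) (by simp [a1]),
        div_mul_cancel₀ _ hx1]
    generalize (y / x).re = r at *
    generalize (z / y).re = t at *
    rw [hz, hy] at h0
    have : ((w 0 + w 1 * r + w 2 * (t * r) : ℝ) : ℂ) * x = 0 := by
      rw [← h0]
      simp only [Complex.real_smul]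
      push_cast
      ring
    rcases mul_eq_zero.1 this with h' | h'
    · have : 0 < w 0 + w 1 * r + w 2 * (t * r) := by positivity
      exact absurd (by exact_mod_cast h') this.ne'
    · exact absurd h' hx0
  · have a1 : 0 < (z / y).im := by
      by_contra! hc
      have : w 2 * ((z / y).im * Complex.normSq y) ≤ 0 :=
        mul_nonpos_of_nonneg_of_nonpos w2.le (mul_nonpos_of_nonpos_of_nonneg hc n1.le)
      have : 0 < w 0 * ((y / x).im * Complex.normSq x) := by positivity
      linarith
    have a2 : 0 < (x / z).im := by
      by_contra! hc
      have : w 2 * ((x / z).im * Complex.normSq z) ≤ 0 :=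
        mul_nonpos_of_nonneg_of_nonpos w2.le (mul_nonpos_of_nonpos_of_nonneg hc n2.le)
      have : 0 < w 1 * ((y / x).im * Complex.normSq x) := by positivity
      linarith
    have := arg_pos_of_im_pos h
    have := arg_pos_of_im_pos a1
    have := arg_pos_of_im_pos a2
    linarith

/-- A segment that misses the boundary of a triangle lies inside it or outside it. -/
theorem mem_convexHull_iff_of_disjoint {v : Fin 3 → ℂ} {x y : ℂ}
    (h : ∀ i, Disjoint (segment ℝ x y) (segment ℝ (v i) (v (i + 1)))) :
    x ∈ convexHull ℝ (Set.range v) ↔ y ∈ convexHull ℝ (Set.range v) := by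
  have e := winding_eq_of_disjoint h
  constructor <;> intro hx <;> by_contra hy
  · rw [winding_eq_zero hy] at e
    exact winding_ne_zero hx
      (fun i hi => Set.disjoint_left.1 (h i) (left_mem_segment ℝ _ _) hi) e
  · rw [winding_eq_zero hy] at e
    exact winding_ne_zero hx
      (fun i hi => Set.disjoint_left.1 (h i) (right_mem_segment ℝ _ _) hi) e.symm

/-! ### Three triangles joined by spokes -/

/-- Each spoke belongs to two neighbouring quadrilaterals, which traverse it in opposite directions,
so only the sides of `p` and the reversed sides of `v` remain. -/
theorem winding_quad_sum {p v : Fin 3 → ℂ} {x : ℂ}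
    (hs : ∀ i, x ∉ segment ℝ (v i) (p i)) (hv : ∀ i, x ∉ segment ℝ (v i) (v (i + 1))) :
    ∑ i, winding ![v i, p i, p (i + 1), v (i + 1)] x = winding p x - winding v x := by
  have h1 : ∀ i, winding ![v i, p i, p (i + 1), v (i + 1)] x
      = turn x (v i) (p i) + turn x (p i) (p (i + 1)) - turn x (v (i + 1)) (p (i + 1))
        - turn x (v i) (v (i + 1)) := by
    intro i
    unfold winding
    rw [Fin.sum_univ_four]
    simp only [show (0 : Fin 4) + 1 = 1 from rfl, show (1 : Fin 4) + 1 = 2 from rfl,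
      show (2 : Fin 4) + 1 = 3 from rfl, show (3 : Fin 4) + 1 = 0 from rfl]
    have e1 := turn_swap (hs (i + 1))
    have e2 := turn_swap (hv i)
    simp only [Matrix.cons_val]
    rw [e1, e2]
    ring
  simp only [h1]
  have h2 := Equiv.sum_comp (Equiv.addRight (1 : Fin 3)) (fun i => turn x (v i) (p i))
  simp only [Equiv.coe_addRight] at h2
  simp only [Finset.sum_sub_distrib, Finset.sum_add_distrib, h2]
  unfold winding
  ring

theorem winding_quad_eq_of_disjoint {p v : Fin 3 → ℂ} {i : Fin 3} {x y : ℂ}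
    (h1 : Disjoint (segment ℝ x y) (segment ℝ (v i) (p i)))
    (h2 : Disjoint (segment ℝ x y) (segment ℝ (p i) (p (i + 1))))
    (h3 : Disjoint (segment ℝ x y) (segment ℝ (v (i + 1)) (p (i + 1))))
    (h4 : Disjoint (segment ℝ x y) (segment ℝ (v i) (v (i + 1)))) :
    winding ![v i, p i, p (i + 1), v (i + 1)] x = winding ![v i, p i, p (i + 1), v (i + 1)] y := by
  apply winding_eq_of_disjoint
  intro j
  fin_cases j
  · exact h1
  · exact h2
  · show Disjoint _ (segment ℝ (p (i + 1)) (v (i + 1)))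
    rwa [segment_symm ℝ (p (i + 1))]
  · show Disjoint _ (segment ℝ (v (i + 1)) (v i))
    rwa [segment_symm ℝ (v (i + 1))]

/-- The straight-line drawing of a triangle `v` with two further triangles `p` and `q` attached to
it by spokes, without crossings. -/
structure IsTriangleStack (p v q : Fin 3 → ℂ) : Prop where
  vertex : ∀ i, v (i + 2) ∉ segment ℝ (v i) (v (i + 1))
  lower : ∀ i j, Disjoint (segment ℝ (p i) (p (i + 1))) (segment ℝ (v j) (v (j + 1)))
  upper : ∀ i j, Disjoint (segment ℝ (q i) (q (i + 1))) (segment ℝ (v j) (v (j + 1)))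
  lower_upper : ∀ i j, Disjoint (segment ℝ (p i) (p (i + 1))) (segment ℝ (q j) (q (j + 1)))
  lowerSpoke : ∀ i j, segment ℝ (v i) (p i) ∩ segment ℝ (v j) (v (j + 1)) ⊆ {v i}
  upperSpoke : ∀ i j, segment ℝ (v i) (q i) ∩ segment ℝ (v j) (v (j + 1)) ⊆ {v i}
  lowerSpoke_upper : ∀ i j, Disjoint (segment ℝ (v i) (p i)) (segment ℝ (q j) (q (j + 1)))
  upperSpoke_lower : ∀ i j, Disjoint (segment ℝ (v i) (q i)) (segment ℝ (p j) (p (j + 1)))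
  spokes : ∀ i j, i ≠ j → Disjoint (segment ℝ (v i) (p i)) (segment ℝ (v j) (q j))

theorem mem_convexHull_succ_iff {s v : Fin 3 → ℂ}
    (h : ∀ i j, Disjoint (segment ℝ (s i) (s (i + 1))) (segment ℝ (v j) (v (j + 1)))) (k : Fin 3) :
    s 0 ∈ convexHull ℝ (Set.range v) ↔ s k ∈ convexHull ℝ (Set.range v) := by
  have h0 := mem_convexHull_iff_of_disjoint (h 0)
  have h1 := mem_convexHull_iff_of_disjoint (h 1)
  fin_cases k
  · exact Iff.rfl
  · exact h0
  · exact h0.trans h1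

/-- Two-dimensional cross product. -/
noncomputable def cross (x y : ℂ) : ℝ := x.re * y.im - x.im * y.re

/-- A vanishing cross product makes the vertices collinear; one of them then lies between the other
two, on the opposite side. -/
theorem cross_ne_zero {v : Fin 3 → ℂ} (h : ∀ i, v (i + 2) ∉ segment ℝ (v i) (v (i + 1)))
    (i : Fin 3) : cross (v (i + 1) - v i) (v (i + 2) - v i) ≠ 0 := by
  intro h0
  have key : ∀ a b c : ℂ, c ∉ segment ℝ a b → a ∉ segment ℝ b c → b ∉ segment ℝ c a →
      cross (b - a) (c - a) ≠ 0 := by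
    intro a b c hc ha hb h0
    have hcol : Collinear ℝ {a, b, c} := by
      have hab : b - a ≠ 0 := fun h' => ha (by
        rw [sub_eq_zero.1 h']; exact left_mem_segment ℝ _ _)
      rw [collinear_iff_of_mem (p₀ := a) (by simp)]
      refine ⟨b - a, ?_⟩
      have hn := Complex.normSq_pos.2 hab
      simp only [Set.mem_insert_iff, Set.mem_singleton_iff, forall_eq_or_imp, forall_eq]
      refine ⟨⟨0, by simp⟩, ⟨1, by simp⟩,
        (((b - a).re * (c - a).re + (b - a).im * (c - a).im) / Complex.normSq (b - a)), ?_⟩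
      rw [vadd_eq_add, ← sub_eq_iff_eq_add]
      unfold cross at h0
      generalize b - a = x at *
      generalize c - a = y at *
      rw [Complex.normSq_apply] at *
      apply Complex.ext
      · simp only [Complex.smul_re, smul_eq_mul]
        rw [div_mul_eq_mul_div, eq_div_iff hn.ne']
        linear_combination (-x.im) * h0
      · simp only [Complex.smul_im, smul_eq_mul]
        rw [div_mul_eq_mul_div, eq_div_iff hn.ne']
        linear_combination (x.re) * h0
    rcases hcol.wbtw_or_wbtw_or_wbtw with h | h | h
    · exact hb (by rw [segment_symm]; exact mem_segment_iff_wbtw.2 h)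
    · exact hc (by rw [segment_symm]; exact mem_segment_iff_wbtw.2 h)
    · exact ha (by rw [segment_symm]; exact mem_segment_iff_wbtw.2 h)
  refine key _ _ _ ?_ ?_ ?_ h0
  · exact h i
  · have := h (i + 1)
    fin_cases i <;> exact this
  · have := h (i + 2)
    fin_cases i <;> exact this

/-- The centroid of a triangle. -/
noncomputable def centroid3 (v : Fin 3 → ℂ) : ℂ := ∑ i, (1 / 3 : ℝ) • v i

section Stack
variable {p v q : Fin 3 → ℂ}

theorem segment_centroid_subset (v : Fin 3 → ℂ) (i : Fin 3) :
    segment ℝ (centroid3 v) (v i) ⊆ convexHull ℝ (Set.range v) := by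
  refine (convex_convexHull ℝ _).segment_subset ?_ (subset_convexHull ℝ _ ⟨i, rfl⟩)
  exact mem_convexHull_range_three.2 ⟨fun _ => 1 / 3, fun _ => by norm_num,
    by simp, rfl⟩

/-- The cross product with the side's direction vanishes on the side, and is a positive multiple of
that of the opposite vertex along the whole segment. -/
theorem segment_centroid_disjoint (h : ∀ i, v (i + 2) ∉ segment ℝ (v i) (v (i + 1)))
    (i : Fin 3) :
    Disjoint (segment ℝ (centroid3 v) (v (i + 2))) (segment ℝ (v i) (v (i + 1))) := by
  have hc := cross_ne_zero h i
  rw [Set.disjoint_left]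
  rintro _ ⟨a, b, ha, hb, hab, rfl⟩ ⟨c, d, hc', hd, hcd, he⟩
  have h1 : cross (v (i + 1) - v i) (a • centroid3 v + b • v (i + 2) - v i)
      = (a / 3 + b) * cross (v (i + 1) - v i) (v (i + 2) - v i) := by
    have hs : centroid3 v = (1 / 3 : ℝ) • v i + (1 / 3 : ℝ) • v (i + 1)
        + (1 / 3 : ℝ) • v (i + 2) := by
      unfold centroid3
      rw [Fin.sum_univ_three]
      fin_cases i
      · rfl
      · show _ = (1 / 3 : ℝ) • v 1 + (1 / 3 : ℝ) • v 2 + (1 / 3 : ℝ) • v 0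
        abel
      · show _ = (1 / 3 : ℝ) • v 2 + (1 / 3 : ℝ) • v 0 + (1 / 3 : ℝ) • v 1
        abel
    rw [hs]
    obtain rfl : b = 1 - a := by linarith
    simp only [cross, Complex.add_re, Complex.add_im, Complex.sub_re, Complex.sub_im,
      Complex.smul_re, Complex.smul_im, smul_eq_mul]
    ring
  have h2 : cross (v (i + 1) - v i) (c • v i + d • v (i + 1) - v i) = 0 := by
    obtain rfl : c = 1 - d := by linarith
    simp only [cross, Complex.add_re, Complex.add_im, Complex.sub_re, Complex.sub_im,
      Complex.smul_re, Complex.smul_im, smul_eq_mul]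
    ring
  rw [he, h1] at h2
  rcases mul_eq_zero.1 h2 with h3 | h3
  · linarith
  · exact hc h3

/-- From any other common point, the rest of the spoke would lead to `p i` without meeting the
boundary, forcing `p` inside. -/
theorem lowerSpoke_inter_hull (h : IsTriangleStack p v q)
    (hp : p 0 ∉ convexHull ℝ (Set.range v)) (i : Fin 3) :
    segment ℝ (v i) (p i) ∩ convexHull ℝ (Set.range v) ⊆ {v i} := by
  rintro y ⟨hy, hyv⟩
  by_contra hne
  have hsub : segment ℝ y (p i) ⊆ segment ℝ (v i) (p i) \ {v i} := by
    intro z hz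
    refine ⟨(convex_segment _ _).segment_subset hy (right_mem_segment ℝ _ _) hz, ?_⟩
    rintro rfl
    exact hne ((mem_segment_iff_wbtw.1 hy).swap_left_iff.1 (mem_segment_iff_wbtw.1 hz)).symm
  refine hp ((mem_convexHull_succ_iff h.lower i).2
    ((mem_convexHull_iff_of_disjoint fun j => ?_).1 hyv))
  rw [Set.disjoint_left]
  intro z hz hz'
  exact (hsub hz).2 (h.lowerSpoke i j ⟨(hsub hz).1, hz'⟩)

theorem lower_disjoint_hull (h : IsTriangleStack p v q)
    (hp : p 0 ∉ convexHull ℝ (Set.range v)) (i : Fin 3) :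
    Disjoint (segment ℝ (p i) (p (i + 1))) (convexHull ℝ (Set.range v)) := by
  rw [Set.disjoint_left]
  intro y hy hyv
  refine hp ((mem_convexHull_succ_iff h.lower i).2
    ((mem_convexHull_iff_of_disjoint fun j => ?_).1 hyv))
  exact (h.lower i j).mono_left
    ((convex_segment _ _).segment_subset hy (left_mem_segment ℝ _ _))

/-- Two triangles attached to a third one do not both lie outside of it. -/
theorem IsTriangleStack.mem_hull (h : IsTriangleStack p v q)
    (hp : p 0 ∉ convexHull ℝ (Set.range v)) : q 0 ∈ convexHull ℝ (Set.range v) := by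
  by_contra hq
  have hspoke_v : ∀ i, Disjoint (segment ℝ (v (i + 2)) (q (i + 2)))
      (segment ℝ (v i) (v (i + 1))) := by
    intro i
    rw [Set.disjoint_left]
    intro z hz hz'
    have := h.upperSpoke (i + 2) i ⟨hz, hz'⟩
    rw [Set.mem_singleton_iff] at this
    exact h.vertex i (this ▸ hz')
  have hi1 : ∀ i : Fin 3, i ≠ i + 2 := by decide
  have hi2 : ∀ i : Fin 3, i + 1 ≠ i + 2 := by decide
  -- the quadrilateral over the side `i` winds equally around `q` and the opposite vertex
  have hQ : ∀ i, winding ![v i, p i, p (i + 1), v (i + 1)] (q 0)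
      = winding ![v i, p i, p (i + 1), v (i + 1)] (v (i + 2)) := by
    intro i
    have e1 : ∀ j, winding ![v i, p i, p (i + 1), v (i + 1)] (q j)
        = winding ![v i, p i, p (i + 1), v (i + 1)] (q (j + 1)) := fun j =>
      winding_quad_eq_of_disjoint (h.lowerSpoke_upper i j).symm (h.lower_upper i j).symm
        (h.lowerSpoke_upper (i + 1) j).symm (h.upper j i)
    have e2 : winding ![v i, p i, p (i + 1), v (i + 1)] (v (i + 2))
        = winding ![v i, p i, p (i + 1), v (i + 1)] (q (i + 2)) :=
      winding_quad_eq_of_disjoint (h.spokes _ _ (hi1 i)).symm (h.upperSpoke_lower _ _)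
        (h.spokes _ _ (hi2 i)).symm (hspoke_v i)
    rw [e2]
    have a0 := e1 0
    have a1 := e1 1
    have a2 := e1 2
    fin_cases i
    · exact a0.trans a1
    · rfl
    · exact a0
  -- The same holds for the centroid. Here `p` outside `v` is needed: its sides and spokes then do
  -- not obstruct the path inside `v` to the opposite vertex.
  have hR : ∀ i, winding ![v i, p i, p (i + 1), v (i + 1)] (centroid3 v)
      = winding ![v i, p i, p (i + 1), v (i + 1)] (v (i + 2)) := by
    intro i
    have hd := segment_centroid_disjoint h.vertex i
    have hsub := segment_centroid_subset v (i + 2)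
    have hsp : ∀ j, v j ∈ segment ℝ (v i) (v (i + 1)) →
        Disjoint (segment ℝ (centroid3 v) (v (i + 2))) (segment ℝ (v j) (p j)) := by
      intro j hj
      rw [Set.disjoint_left]
      intro z hz hz'
      have := lowerSpoke_inter_hull h hp j ⟨hz', hsub hz⟩
      rw [Set.mem_singleton_iff] at this
      exact Set.disjoint_left.1 hd hz (this ▸ hj)
    exact winding_quad_eq_of_disjoint (hsp i (left_mem_segment ℝ _ _))
      ((lower_disjoint_hull h hp i).symm.mono_left hsub)
      (hsp (i + 1) (right_mem_segment ℝ _ _)) hd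
  have sQ := winding_quad_sum (p := p) (v := v) (x := q 0)
    (fun i hi => Set.disjoint_left.1 (h.lowerSpoke_upper i 0) hi (left_mem_segment ℝ _ _))
    (fun i hi => Set.disjoint_left.1 (h.upper 0 i) (left_mem_segment ℝ _ _) hi)
  have hcv : ∀ i, centroid3 v ∉ segment ℝ (v i) (v (i + 1)) := fun i hi =>
    Set.disjoint_left.1 (segment_centroid_disjoint h.vertex i) (left_mem_segment ℝ _ _) hi
  have hcm := segment_centroid_subset v 0 (left_mem_segment ℝ _ _)
  have sR := winding_quad_sum (p := p) (v := v) (x := centroid3 v)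
    (fun i hi => by
      have := lowerSpoke_inter_hull h hp i ⟨hi, hcm⟩
      rw [Set.mem_singleton_iff] at this
      exact hcv i (this ▸ left_mem_segment ℝ _ _)) hcv
  simp only [hQ] at sQ
  simp only [hR] at sR
  -- The quadrilateral sums agree at `q 0` and the centroid; via `v 0`, so does the winding of `p`.
  -- Only the winding of `v` is left to compare.
  have pQ : winding p (v 0) = winding p (q 0) :=
    winding_eq_of_disjoint fun i => h.upperSpoke_lower 0 i
  have pR : winding p (centroid3 v) = winding p (v 0) :=
    winding_eq_of_disjoint fun i =>
      (lower_disjoint_hull h hp i).symm.mono_left (segment_centroid_subset v 0)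
  have := winding_eq_zero hq
  have := winding_ne_zero hcm hcv
  apply this
  linarith

end Stack

/-! ### Three consecutive triangles of the graph -/

/-- Adjacency of the nested triangles, on the indices `0, 1, …`. -/
def NestedAdj (u v : ℕ) : Prop := u ≠ v ∧ (u / 3 = v / 3 ∨ u + 3 = v ∨ v + 3 = u)

/-- The edges of the nested triangles `a`, `a + 1`, `a + 2` do not cross when each vertex `k` is
drawn at `P k`. -/
structure IsNoncrossingAt (P : ℕ → ℂ) (a : ℕ) : Prop where
  inj : ∀ x ∈ Set.Ico (3 * a) (3 * a + 9), ∀ y ∈ Set.Ico (3 * a) (3 * a + 9), P x = P y → x = y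
  inter : ∀ u ∈ Set.Ico (3 * a) (3 * a + 9), ∀ v ∈ Set.Ico (3 * a) (3 * a + 9),
    ∀ u' ∈ Set.Ico (3 * a) (3 * a + 9), ∀ v' ∈ Set.Ico (3 * a) (3 * a + 9),
    NestedAdj u v → NestedAdj u' v' → ¬ (u = u' ∧ v = v' ∨ u = v' ∧ v = u') →
    ∀ z ∈ segment ℝ (P u) (P v), z ∈ segment ℝ (P u') (P v') →
      ∃ x, P x = z ∧ (x = u ∨ x = v) ∧ (x = u' ∨ x = v')

/-- Two sides of a triangle share only their common end, so a vertex lying on the opposite side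
would coincide with another vertex. -/
theorem IsNoncrossingAt.vertex {P : ℕ → ℂ} {a b : ℕ} (h : IsNoncrossingAt P a) (hab : a ≤ b)
    (hba : b ≤ a + 2) (i : Fin 3) :
    P (3 * b + (i + 2 : Fin 3)) ∉ segment ℝ (P (3 * b + i)) (P (3 * b + (i + 1 : Fin 3))) := by
  intro hi
  have := i.2
  have h1 : ((i + 1 : Fin 3) : ℕ) = (i + 1) % 3 := Fin.val_add i 1
  have h2 : ((i + 2 : Fin 3) : ℕ) = (i + 2) % 3 := Fin.val_add i 2
  obtain ⟨x, hx, hx1, hx2⟩ := h.inter (3 * b + (i + 2 : Fin 3)) ⟨by omega, by omega⟩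
    (3 * b + i) ⟨by omega, by omega⟩ (3 * b + i) ⟨by omega, by omega⟩
    (3 * b + (i + 1 : Fin 3)) ⟨by omega, by omega⟩ ⟨by omega, by omega⟩
    ⟨by omega, by omega⟩ (by omega) _ (left_mem_segment ℝ _ _) hi
  have := h.inj x ⟨by omega, by omega⟩ _ ⟨by omega, by omega⟩ hx
  omega

theorem IsNoncrossingAt.isTriangleStack {P : ℕ → ℂ} {a : ℕ} (h : IsNoncrossingAt P a) :
    IsTriangleStack (fun i => P (3 * a + i)) (fun i => P (3 * (a + 1) + i))
      (fun i => P (3 * (a + 2) + i)) := by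
  have hv1 : ∀ i : Fin 3, ((i + 1 : Fin 3) : ℕ) = (i + 1) % 3 := fun i => Fin.val_add i 1
  have dis : ∀ u v u' v', u ∈ Set.Ico (3 * a) (3 * a + 9) → v ∈ Set.Ico (3 * a) (3 * a + 9) →
      u' ∈ Set.Ico (3 * a) (3 * a + 9) → v' ∈ Set.Ico (3 * a) (3 * a + 9) →
      NestedAdj u v → NestedAdj u' v' → u ≠ u' → u ≠ v' → v ≠ u' → v ≠ v' →
      Disjoint (segment ℝ (P u) (P v)) (segment ℝ (P u') (P v')) := by
    intro u v u' v' hu hv hu' hv' huv huv' h1 h2 h3 h4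
    rw [Set.disjoint_left]
    intro z hz hz'
    obtain ⟨x, -, hx1, hx2⟩ := h.inter u hu v hv u' hu' v' hv' huv huv' (by omega) z hz hz'
    omega
  refine ⟨?_, ?_, ?_, ?_, ?_, ?_, ?_, ?_, ?_⟩
  · exact h.vertex (Nat.le_succ a) (Nat.le_succ _)
  · intro i j
    have := i.2
    have := j.2
    have h1 := hv1 i
    have h2 := hv1 j
    apply dis <;> first | omega | (constructor <;> omega)
  · intro i j
    have := i.2
    have := j.2
    have h1 := hv1 i
    have h2 := hv1 j
    apply dis <;> first | omega | (constructor <;> omega)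
  · intro i j
    have := i.2
    have := j.2
    have h1 := hv1 i
    have h2 := hv1 j
    apply dis <;> first | omega | (constructor <;> omega)
  · rintro i j z ⟨hz, hz'⟩
    have := i.2
    have := j.2
    have h1 := hv1 j
    obtain ⟨x, rfl, hx1, hx2⟩ := h.inter (3 * (a + 1) + i) ⟨by omega, by omega⟩
      (3 * a + i) ⟨by omega, by omega⟩ (3 * (a + 1) + j) ⟨by omega, by omega⟩
      (3 * (a + 1) + (j + 1 : Fin 3)) ⟨by omega, by omega⟩ ⟨by omega, by omega⟩
      ⟨by omega, by omega⟩ (by omega) z hz hz'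
    rw [Set.mem_singleton_iff, show x = 3 * (a + 1) + i by omega]
  · rintro i j z ⟨hz, hz'⟩
    have := i.2
    have := j.2
    have h1 := hv1 j
    obtain ⟨x, rfl, hx1, hx2⟩ := h.inter (3 * (a + 1) + i) ⟨by omega, by omega⟩
      (3 * (a + 2) + i) ⟨by omega, by omega⟩ (3 * (a + 1) + j) ⟨by omega, by omega⟩
      (3 * (a + 1) + (j + 1 : Fin 3)) ⟨by omega, by omega⟩ ⟨by omega, by omega⟩
      ⟨by omega, by omega⟩ (by omega) z hz hz'
    rw [Set.mem_singleton_iff, show x = 3 * (a + 1) + i by omega]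
  · intro i j
    have := i.2
    have := j.2
    have h2 := hv1 j
    apply dis <;> first | omega | (constructor <;> omega)
  · intro i j
    have := i.2
    have := j.2
    have h2 := hv1 j
    apply dis <;> first | omega | (constructor <;> omega)
  · intro i j hij
    have := i.2
    have := j.2
    have : (i : ℕ) ≠ j := fun h => hij (Fin.ext h)
    apply dis <;> first | omega | (constructor <;> omega)

/-! ### Growth of nested triangles on the grid -/

/-- A point in the interior of a non-degenerate triangle does not maximize a coordinate. -/
theorem exists_lt_of_mem_convexHull {v : Fin 3 → ℂ} {p : ℂ}
    (hv : ∀ i, v (i + 2) ∉ segment ℝ (v i) (v (i + 1)))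
    (hp : p ∈ convexHull ℝ (Set.range v)) (hb : ∀ i, p ∉ segment ℝ (v i) (v (i + 1)))
    (f : ℂ →ₗ[ℝ] ℝ) (hf : f ≠ 0) : ∃ i, f p < f (v i) := by
  by_contra! hle
  obtain ⟨w, hw, hw1, hwp⟩ := exists_pos_weights hp hb
  have hs : ∑ i, w i * (f p - f (v i)) = 0 := by
    simp only [mul_sub, Finset.sum_sub_distrib, ← Finset.sum_mul, hw1, ← hwp, map_sum, map_smul,
      smul_eq_mul]
    ring
  -- At a maximum, the positive weights force `f` to be constant on the vertices; non-degeneracy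
  -- then gives `f = 0`.
  have heq : ∀ i, f (v i) = f p := by
    intro i
    have := (Finset.sum_eq_zero_iff_of_nonneg (fun i _ =>
      mul_nonneg (hw i).le (sub_nonneg.2 (hle i)))).1 hs i (Finset.mem_univ _)
    rcases mul_eq_zero.1 this with h | h
    · exact absurd h (hw i).ne'
    · linarith
  have hz : ∀ z : ℂ, f z = z.re * f 1 + z.im * f Complex.I := by
    intro z
    have : z = z.re • (1 : ℂ) + z.im • Complex.I := by
      apply Complex.ext <;> simp
    conv_lhs => rw [this, map_add, map_smul, map_smul]
    simp
  have h1 : f (v 1 - v 0) = 0 := by rw [map_sub, heq, heq, sub_self]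
  have h2 : f (v 2 - v 0) = 0 := by rw [map_sub, heq, heq, sub_self]
  have hc := cross_ne_zero hv 0
  simp only [zero_add] at hc
  rw [hz] at h1 h2
  unfold cross at hc
  have e1 : f 1 = 0 := by
    refine (mul_eq_zero.1 (?_ : _ * f 1 = 0)).resolve_left hc
    linear_combination (v 2 - v 0).im * h1 - (v 1 - v 0).im * h2
  have e2 : f Complex.I = 0 := by
    refine (mul_eq_zero.1 (?_ : _ * f Complex.I = 0)).resolve_left hc
    linear_combination (v 1 - v 0).re * h2 - (v 2 - v 0).re * h1
  exact hf (LinearMap.ext fun z => by rw [hz, e1, e2]; simp)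

/-- Two triangles with disjoint boundaries, the second one being non-degenerate. -/
structure AreNestable (s v : Fin 3 → ℂ) : Prop where
  vertex : ∀ i, v (i + 2) ∉ segment ℝ (v i) (v (i + 1))
  disjoint : ∀ i j, Disjoint (segment ℝ (s i) (s (i + 1))) (segment ℝ (v j) (v (j + 1)))

theorem AreNestable.exists_lt {s v : Fin 3 → ℂ} (h : AreNestable s v)
    (hs : s 0 ∈ convexHull ℝ (Set.range v)) (f : ℂ →ₗ[ℝ] ℝ) (hf : f ≠ 0) (k : Fin 3) :
    ∃ i, f (s k) < f (v i) :=
  exists_lt_of_mem_convexHull h.vertex ((mem_convexHull_succ_iff h.disjoint k).1 hs)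
    (fun j hj => Set.disjoint_left.1 (h.disjoint k j) (left_mem_segment ℝ _ _) hj) f hf

theorem re_ne_zero : Complex.reLm ≠ 0 := fun h => by
  simpa using LinearMap.congr_fun h 1

theorem im_ne_zero : Complex.imLm ≠ 0 := fun h => by
  simpa using LinearMap.congr_fun h Complex.I

/-- Mutual containment would push the maximal real part of `s` strictly beyond itself. -/
theorem AreNestable.not_mem_of_mem {s v : Fin 3 → ℂ} (h : AreNestable s v) (h' : AreNestable v s)
    (hs : s 0 ∈ convexHull ℝ (Set.range v)) : v 0 ∉ convexHull ℝ (Set.range s) := by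
  intro hv
  obtain ⟨k, hk⟩ := Finite.exists_max fun k => Complex.reLm (s k)
  obtain ⟨i, hi⟩ := h.exists_lt hs _ re_ne_zero k
  obtain ⟨j, hj⟩ := h'.exists_lt hv _ re_ne_zero i
  exact absurd (hk j) (by linarith)

/-- Three points that span at least `d` in both coordinates. -/
def HasExtent (s : Fin 3 → ℂ) (d : ℕ) : Prop :=
  (∃ i j, (d : ℝ) ≤ (s i).re - (s j).re) ∧ ∃ i j, (d : ℝ) ≤ (s i).im - (s j).im

theorem HasExtent.mono {s : Fin 3 → ℂ} {d e : ℕ} (h : HasExtent s e) (hd : d ≤ e) :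
    HasExtent s d := by
  obtain ⟨⟨i, j, h1⟩, k, l, h2⟩ := h
  have : (d : ℝ) ≤ e := by exact_mod_cast hd
  exact ⟨⟨i, j, by linarith⟩, k, l, by linarith⟩

theorem hasExtent_zero (s : Fin 3 → ℂ) : HasExtent s 0 :=
  ⟨⟨0, 0, by simp⟩, 0, 0, by simp⟩

/-- Both extremes of a coordinate move strictly outwards, by at least 1 each since coordinates are
integers. The minimum is handled by `-f`. -/
theorem AreNestable.hasExtent {s v : Fin 3 → ℂ} (h : AreNestable s v)
    (hs : s 0 ∈ convexHull ℝ (Set.range v))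
    (is : ∀ i, ∃ x y : ℤ, s i = ⟨x, y⟩) (iv : ∀ i, ∃ x y : ℤ, v i = ⟨x, y⟩) {d : ℕ}
    (hd : HasExtent s d) : HasExtent v (d + 2) := by
  have key : ∀ f : ℂ →ₗ[ℝ] ℝ, f ≠ 0 → (∀ i, ∃ x : ℤ, f (s i) = x) → (∀ i, ∃ x : ℤ, f (v i) = x) →
      (∃ i j, (d : ℝ) ≤ f (s i) - f (s j)) → ∃ i j, ((d + 2 : ℕ) : ℝ) ≤ f (v i) - f (v j) := by
    rintro f hf hfs hfv ⟨i, j, hij⟩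
    obtain ⟨i', hi'⟩ := h.exists_lt hs f hf i
    obtain ⟨j', hj'⟩ := h.exists_lt hs (-f) (neg_ne_zero.2 hf) j
    refine ⟨i', j', ?_⟩
    obtain ⟨a, ha⟩ := hfs i
    obtain ⟨b, hb⟩ := hfs j
    obtain ⟨a', ha'⟩ := hfv i'
    obtain ⟨b', hb'⟩ := hfv j'
    simp only [LinearMap.neg_apply] at hj'
    rw [ha, ha'] at hi'
    rw [hb, hb'] at hj'
    rw [ha, hb] at hij
    rw [ha', hb']
    have h1 : a < a' := by exact_mod_cast hi'
    have h2 : b' < b := by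
      have : (b' : ℝ) < b := by linarith
      exact_mod_cast this
    have h3 : (d : ℤ) ≤ a - b := by exact_mod_cast hij
    have h4 : ((d + 2 : ℕ) : ℤ) ≤ a' - b' := by push_cast; omega
    exact_mod_cast h4
  refine ⟨key Complex.reLm re_ne_zero (fun i => ?_) (fun i => ?_) hd.1,
    key Complex.imLm im_ne_zero (fun i => ?_) (fun i => ?_) hd.2⟩
  · obtain ⟨x, y, e⟩ := is i
    exact ⟨x, by simp [e]⟩
  · obtain ⟨x, y, e⟩ := iv i
    exact ⟨x, by simp [e]⟩
  · obtain ⟨x, y, e⟩ := is i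
    exact ⟨y, by simp [e]⟩
  · obtain ⟨x, y, e⟩ := iv i
    exact ⟨y, by simp [e]⟩

/-- Along a sequence of triangles in which any three consecutive ones are drawn without crossings,
the triangles grow up to some index and shrink afterwards; so one of them is large. -/
theorem exists_hasExtent {T : ℕ → Fin 3 → ℂ} {m : ℕ} (hm : 0 < m)
    (hT : ∀ i, i + 1 < m → AreNestable (T i) (T (i + 1)) ∧ AreNestable (T (i + 1)) (T i))
    (hmem : ∀ i, i + 2 < m → T i 0 ∉ convexHull ℝ (Set.range (T (i + 1))) →
      T (i + 2) 0 ∈ convexHull ℝ (Set.range (T (i + 1))))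
    (hint : ∀ i < m, ∀ j, ∃ x y : ℤ, T i j = ⟨x, y⟩) :
    ∃ i < m, HasExtent (T i) (m - 2) := by
  have up : ∀ s < m, (∀ i < s, T i 0 ∈ convexHull ℝ (Set.range (T (i + 1)))) →
      HasExtent (T s) (2 * s) := by
    intro s
    induction s with
    | zero => exact fun _ _ => hasExtent_zero _
    | succ s ih =>
      intro hs hin
      exact (hT s hs).1.hasExtent (hin s (by omega)) (hint s (by omega)) (hint _ hs)
        (ih (by omega) fun i hi => hin i (by omega))
  by_cases hall : ∀ i, i + 1 < m → T i 0 ∈ convexHull ℝ (Set.range (T (i + 1)))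
  · exact ⟨m - 1, by omega, (up (m - 1) (by omega) fun i hi => hall i (by omega)).mono (by omega)⟩
  classical
  have hex : ∃ i, i + 1 < m ∧ T i 0 ∉ convexHull ℝ (Set.range (T (i + 1))) := by
    push Not at hall
    exact hall
  obtain ⟨s, ⟨hsm, hs⟩, hmin⟩ : ∃ s, (s + 1 < m ∧ T s 0 ∉ convexHull ℝ (Set.range (T (s + 1)))) ∧
      ∀ i < s, T i 0 ∈ convexHull ℝ (Set.range (T (i + 1))) := by
    refine ⟨Nat.find hex, Nat.find_spec hex, fun i hi => ?_⟩
    have h1 := Nat.find_min hex hi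
    have h2 := (Nat.find_spec hex).1
    by_contra hc
    exact h1 ⟨by omega, hc⟩
  -- Once a triangle contains its successor it is not contained in it, so the stack property applies
  -- again one step further.
  have down : ∀ k, s + k + 2 < m →
      T (s + k + 2) 0 ∈ convexHull ℝ (Set.range (T (s + k + 1))) := by
    intro k
    induction k with
    | zero => exact fun hk => hmem s hk hs
    | succ k ih =>
      intro hk
      have h1 := hT (s + k + 1) (by omega)
      exact hmem (s + k + 1) (by omega) (h1.2.not_mem_of_mem h1.1 (ih (by omega)))
  -- Growth counted backwards from the last triangle; the bound on `k` stops at index `s + 1`.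
  have ext : ∀ k, k + s + 2 ≤ m → HasExtent (T (m - 1 - k)) (2 * k) := by
    intro k
    induction k with
    | zero => exact fun _ => hasExtent_zero _
    | succ k ih =>
      intro hk
      have h1 := ih (by omega)
      have h2 := down (m - 3 - k - s) (by omega)
      have h3 := hT (m - 2 - k) (by omega)
      rw [show s + (m - 3 - k - s) + 2 = m - 1 - k by omega,
        show s + (m - 3 - k - s) + 1 = m - 1 - (k + 1) by omega] at h2
      rw [show m - 2 - k + 1 = m - 1 - k by omega,
        show m - 2 - k = m - 1 - (k + 1) by omega] at h3
      exact h3.2.hasExtent h2 (hint _ (by omega)) (hint _ (by omega)) h1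
  -- Triangles `s` and `s + 1` have extents `2 * s` and `2 * (m - 2 - s)`, which sum to `2 * (m -
  -- 2)`.
  by_cases hc : m - 2 ≤ 2 * s
  · exact ⟨s, by omega, (up s (by omega) hmin).mono hc⟩
  · exact ⟨m - 1 - (m - 2 - s), by omega, (ext (m - 2 - s) (by omega)).mono (by omega)⟩

/-- The three vertices of the `i`-th nested triangle. -/
def triangleAt (P : ℕ → ℂ) (i : ℕ) (j : Fin 3) : ℂ := P (3 * i + j)

namespace IsNoncrossingAt

theorem exists_hasExtent {P : ℕ → ℂ} {m : ℕ} (hm : 0 < m)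
    (h : ∀ i, i + 2 < m → IsNoncrossingAt P i)
    (hint : ∀ k < 3 * m, ∃ x y : ℤ, P k = ⟨x, y⟩) :
    ∃ i < m, HasExtent (triangleAt P i) (m - 2) := by
  by_cases hm2 : m ≤ 2
  · exact ⟨0, hm, (hasExtent_zero _).mono (by omega)⟩
  refine _root_.exists_hasExtent (T := triangleAt P) hm (fun i hi => ?_) (fun i hi => ?_)
    fun i hi j => hint _ (by omega)
  · by_cases h2 : i + 2 < m
    · have hi' := h i h2
      exact ⟨⟨hi'.vertex (Nat.le_succ i) (Nat.le_succ _), hi'.isTriangleStack.lower⟩,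
        ⟨hi'.vertex le_rfl (by omega), fun j k => (hi'.isTriangleStack.lower k j).symm⟩⟩
    -- No window starts at the last pair; it forms the upper part of the preceding window.
    · obtain ⟨a, rfl⟩ : ∃ a, i = a + 1 := ⟨i - 1, by omega⟩
      have hi' := h a (by omega)
      exact ⟨⟨hi'.vertex (by omega) le_rfl, fun j k => (hi'.isTriangleStack.upper k j).symm⟩,
        ⟨hi'.vertex (Nat.le_succ _) (Nat.le_succ _), hi'.isTriangleStack.upper⟩⟩
  · exact (h i hi).isTriangleStack.mem_hull

end IsNoncrossingAt

/-! ### From drawing stories to large grids -/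

/-- The positions of the vertices in a planar straight-line grid drawing story. -/
theorem DrawingStory.exists_pos {V : Type} [Fintype V] {S : GraphStory V} (Γ : DrawingStory S)
    (hΓ : Γ.IsPlanarStraightLineGrid) (hW : 0 < S.W) :
    ∃ P : V → ℝ × ℝ,
      (∀ (t : S.Time) (v : V) (hv : v ∈ S.present t), (Γ.drawing t).pos ⟨v, hv⟩ = P v) ∧
      (∀ v, ∃ x y : ℤ, P v = ((x : ℝ), (y : ℝ))) ∧
      (∀ (t : S.Time), Set.InjOn P (S.present t)) ∧
      ∀ (t : S.Time), ∀ u ∈ S.present t, ∀ v ∈ S.present t, ∀ u' ∈ S.present t,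
        ∀ v' ∈ S.present t, S.graph.Adj u v → S.graph.Adj u' v' → s(u, v) ≠ s(u', v') →
        ∀ z ∈ segment ℝ (P u) (P v), z ∈ segment ℝ (P u') (P v') →
          ∃ x, P x = z ∧ (x = u ∨ x = v) ∧ (x = u' ∨ x = v') := by
  have hτ : ∀ v, S.τ v ∈ Set.Icc 1 (Fintype.card V + S.W - 1) := fun v => by
    have := S.bijOn_τ.mapsTo (Set.mem_univ v)
    simp only [Set.mem_Icc] at this ⊢
    omega
  -- A nonempty window makes each vertex present at its own arrival time, from which its position is
  -- read off.
  have hpr : ∀ v, v ∈ S.present (S.τ v) := fun v => ⟨by omega, le_rfl⟩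
  have hpos : ∀ (t : S.Time) (v : V) (hv : v ∈ S.present t), (Γ.drawing t).pos ⟨v, hv⟩
      = (Γ.drawing ⟨S.τ v, hτ v⟩).pos ⟨v, hpr v⟩ := fun t v hv => Γ.pos_eq _ _ _ _ _
  refine ⟨fun v => (Γ.drawing ⟨S.τ v, hτ v⟩).pos ⟨v, hpr v⟩, hpos, fun v => (hΓ _).2.2 _, ?_, ?_⟩
  · intro t u hu v hv huv
    simp only [← hpos t u hu, ← hpos t v hv] at huv
    exact congrArg Subtype.val ((Γ.drawing t).pos_injective huv)
  · intro t u hu v hv u' hu' v' hv' ha ha' hne z hz hz'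
    simp only [← hpos t u hu, ← hpos t v hv] at hz
    simp only [← hpos t u' hu', ← hpos t v' hv'] at hz'
    have ga : (S.graphAt t).Adj ⟨u, hu⟩ ⟨v, hv⟩ := ha
    have ga' : (S.graphAt t).Adj ⟨u', hu'⟩ ⟨v', hv'⟩ := ha'
    rw [← (hΓ t).2.1 _ _ ga] at hz
    rw [← (hΓ t).2.1 _ _ ga'] at hz'
    obtain ⟨⟨x, hx⟩, ⟨hx1, hx2⟩, hxz⟩ := (hΓ t).1 _ ga _ ga' (fun he => hne (by
      have := congrArg (Sym2.map Subtype.val) he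
      simpa using this)) ⟨hz, hz'⟩
    refine ⟨x, (hpos t x hx).symm.trans hxz, ?_, ?_⟩
    · simpa [Sym2.mem_iff] using hx1
    · simpa [Sym2.mem_iff] using hx2

theorem nestedTriangles_adj {n : ℕ} {u v : Fin n} :
    (nestedTriangles n).Adj u v ↔ NestedAdj u v := by
  simp only [nestedTriangles, SimpleGraph.fromRel_adj, NestedAdj, ne_eq, Fin.ext_iff]
  constructor <;> rintro ⟨h1, h2⟩ <;> refine ⟨h1, ?_⟩ <;> omega

theorem mem_present_nestedTrianglesStory {n t : ℕ} {v : Fin n} :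
    v ∈ (nestedTrianglesStory n).present t ↔ t < (v : ℕ) + 10 ∧ (v : ℕ) + 1 ≤ t := Iff.rfl

theorem Drawing.LiesOn.mem {V : Type} {G : SimpleGraph V} {D : Drawing G} {w h : ℕ}
    (hD : D.LiesOn w h) : 2 ≤ w ∧ 2 ≤ h ∧ ∀ u v, (D.pos u).1 - (D.pos v).1 + 1 ≤ w ∧
      (D.pos u).2 - (D.pos v).2 + 1 ≤ h := by
  obtain ⟨a, b, c, d, hab, hcd, hw, hh, hsub⟩ := hD
  have hmem : ∀ u, D.pos u ∈ Set.Icc (a : ℝ) (b : ℝ) ×ˢ Set.Icc (c : ℝ) (d : ℝ) :=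
    fun u => hsub (Or.inl ⟨u, rfl⟩)
  have hw' : (b : ℝ) - a + 1 = w := by exact_mod_cast hw
  have hh' : (d : ℝ) - c + 1 = h := by exact_mod_cast hh
  refine ⟨by omega, by omega, fun u v => ?_⟩
  obtain ⟨⟨hu1, hu2⟩, hu3, hu4⟩ := hmem u
  obtain ⟨⟨hv1, hv2⟩, hv3, hv4⟩ := hmem v
  constructor <;> linarith

/-- At some time, every planar straight-line grid drawing story of the nested triangles needs a
large grid. -/
theorem exists_large_drawing {m : ℕ} (hm : 0 < m) (Γ : DrawingStory (nestedTrianglesStory (3 * m)))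
    (hΓ : Γ.IsPlanarStraightLineGrid) :
    ∃ t : (nestedTrianglesStory (3 * m)).Time, ∀ w h : ℕ, (Γ.drawing t).LiesOn w h →
      m ≤ 2 * w ∧ m ≤ 2 * h := by
  obtain ⟨P, hP, hint, hinj, hinter⟩ := Γ.exists_pos hΓ (by decide : 0 < 9)
  -- At time `3 * i + 3` the last vertex of triangle `i` has just arrived, and the window reaches
  -- back to triangle `i - 2` (if it exists).
  have htime : ∀ i < m, 3 * i + 3 ∈
      Set.Icc 1 (Fintype.card (Fin (3 * m)) + (nestedTrianglesStory (3 * m)).W - 1) := by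
    intro i hi
    simp only [Fintype.card_fin, nestedTrianglesStory, Set.mem_Icc]
    omega
  set e : (ℝ × ℝ) ≃ₗ[ℝ] ℂ := Complex.equivRealProdLm.symm with he
  set Q : ℕ → ℂ := fun k => if hk : k < 3 * m then e (P ⟨k, hk⟩) else 0 with hQ
  have hQk : ∀ (k : ℕ) (hk : k < 3 * m), Q k = e (P ⟨k, hk⟩) := fun k hk => by simp [hQ, hk]
  have hseg : ∀ (k l : ℕ) (hk : k < 3 * m) (hl : l < 3 * m), ∀ z ∈ segment ℝ (Q k) (Q l),
      e.symm z ∈ segment ℝ (P ⟨k, hk⟩) (P ⟨l, hl⟩) := by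
    intro k l hk hl z hz
    rw [hQk k hk, hQk l hl] at hz
    obtain ⟨a, b, ha, hb, hab, rfl⟩ := hz
    refine ⟨a, b, ha, hb, hab, ?_⟩
    rw [map_add, map_smul, map_smul, e.symm_apply_apply, e.symm_apply_apply]
  have hnc : ∀ i, i + 2 < m → IsNoncrossingAt Q i := by
    intro i hi
    have hpres : ∀ k (hk : k < 3 * m), k ∈ Set.Ico (3 * i) (3 * i + 9) →
        (⟨k, hk⟩ : Fin (3 * m)) ∈ (nestedTrianglesStory (3 * m)).present (3 * (i + 2) + 3) := by
      rintro k hk ⟨h1, h2⟩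
      rw [mem_present_nestedTrianglesStory]
      constructor <;> simp only [] <;> omega
    refine ⟨fun x hx y hy hxy => ?_, fun u hu v hv u' hu' v' hv' ha ha' hne z hz hz' => ?_⟩
    · have hx3 : x < 3 * m := by have := hx.2; omega
      have hy3 : y < 3 * m := by have := hy.2; omega
      rw [hQk x hx3, hQk y hy3] at hxy
      have := hinj ⟨3 * (i + 2) + 3, htime _ hi⟩ (hpres x hx3 hx) (hpres y hy3 hy)
        (e.injective hxy)
      simpa using this
    · have hu3 : u < 3 * m := by have := hu.2; omega
      have hv3 : v < 3 * m := by have := hv.2; omega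
      have hu3' : u' < 3 * m := by have := hu'.2; omega
      have hv3' : v' < 3 * m := by have := hv'.2; omega
      obtain ⟨x, hx, hx1, hx2⟩ := hinter ⟨3 * (i + 2) + 3, htime _ hi⟩ ⟨u, hu3⟩ (hpres u hu3 hu)
        ⟨v, hv3⟩ (hpres v hv3 hv) ⟨u', hu3'⟩ (hpres u' hu3' hu') ⟨v', hv3'⟩ (hpres v' hv3' hv')
        (nestedTriangles_adj.2 ha) (nestedTriangles_adj.2 ha')
        (by
          rw [Ne, Sym2.eq_iff]
          simpa [Fin.ext_iff] using hne)
        _ (hseg u v hu3 hv3 z hz) (hseg u' v' hu3' hv3' z hz')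
      refine ⟨x, ?_, ?_, ?_⟩
      · rw [hQk x x.2, Fin.eta, hx, e.apply_symm_apply]
      · simpa [Fin.ext_iff] using hx1
      · simpa [Fin.ext_iff] using hx2
  obtain ⟨i, hi, hext⟩ := IsNoncrossingAt.exists_hasExtent hm hnc fun k hk => by
    obtain ⟨x, y, hxy⟩ := hint ⟨k, hk⟩
    refine ⟨x, y, ?_⟩
    rw [hQk k hk, hxy]
    rfl
  refine ⟨⟨3 * i + 3, htime i hi⟩, fun w h hwh => ?_⟩
  obtain ⟨hw2, hh2, hwh⟩ := hwh.mem
  have hpres : ∀ j : Fin 3, (⟨3 * i + j, by omega⟩ : Fin (3 * m)) ∈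
      (nestedTrianglesStory (3 * m)).present (3 * i + 3) := by
    intro j
    rw [mem_present_nestedTrianglesStory]
    constructor <;> simp only [] <;> omega
  have hre : ∀ j : Fin 3, triangleAt Q i j
      = e ((Γ.drawing ⟨3 * i + 3, htime i hi⟩).pos ⟨_, hpres j⟩) := by
    intro j
    rw [hP ⟨3 * i + 3, htime i hi⟩ _ (hpres j)]
    exact hQk _ _
  have hre' : ∀ x : ℝ × ℝ, (e x).re = x.1 := fun x => rfl
  have him' : ∀ x : ℝ × ℝ, (e x).im = x.2 := fun x => rfl
  obtain ⟨⟨j, k, hjk⟩, j', k', hjk'⟩ := hext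
  rw [hre, hre, hre', hre'] at hjk
  rw [hre, hre, him', him'] at hjk'
  have h1 := (hwh ⟨_, hpres j⟩ ⟨_, hpres k⟩).1
  have h2 := (hwh ⟨_, hpres j'⟩ ⟨_, hpres k'⟩).2
  have h3 : m - 2 + 1 ≤ w := by
    have : ((m - 2 : ℕ) : ℝ) + 1 ≤ w := by linarith
    exact_mod_cast this
  have h4 : m - 2 + 1 ≤ h := by
    have : ((m - 2 : ℕ) : ℝ) + 1 ≤ h := by linarith
    exact_mod_cast this
  omega

/-! ### Straight-line drawings from vertex positions -/

/-- The straight-line drawing with given positions of the vertices. -/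
def Drawing.straightLine {V : Type} (G : SimpleGraph V) (P : V → ℝ × ℝ)
    (hP : Function.Injective P) : Drawing G where
  pos := P
  arc := Sym2.lift ⟨fun u v => segment ℝ (P u) (P v), fun _ _ => segment_symm ℝ _ _⟩
  pos_injective := hP
  isJordanArc := by
    intro u v huv
    have hne : P u ≠ P v := fun h => huv.ne (hP h)
    refine ⟨⟨⟨fun t : unitInterval => AffineMap.lineMap (P u) (P v) (t : ℝ), by fun_prop⟩,
      by simp, by simp⟩, ?_, ?_⟩
    · intro s t hst
      exact Subtype.ext (AffineMap.lineMap_injective ℝ hne hst)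
    · change _ = segment ℝ (P u) (P v)
      rw [segment_eq_image_lineMap, Set.image_eq_range]
      rfl

theorem Drawing.straightLine_isPlanar {V : Type} {G : SimpleGraph V} {P : V → ℝ × ℝ}
    {hP : Function.Injective P}
    (h : ∀ u v u' v', G.Adj u v → G.Adj u' v' → s(u, v) ≠ s(u', v') →
      ∀ z ∈ segment ℝ (P u) (P v), z ∈ segment ℝ (P u') (P v') →
        ∃ x, P x = z ∧ (x = u ∨ x = v) ∧ (x = u' ∨ x = v')) :
    (Drawing.straightLine G P hP).IsPlanar := by
  intro e he f hf hef z hz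
  induction e with | _ u v
  induction f with | _ u' v'
  obtain ⟨x, hx, hx1, hx2⟩ := h u v u' v' he hf hef z hz.1 hz.2
  exact ⟨x, ⟨by simpa using hx1, by simpa using hx2⟩, hx⟩

/-- The straight-line drawing story with given positions of the vertices. -/
def DrawingStory.straightLine {V : Type} [Fintype V] (S : GraphStory V) (P : V → ℝ × ℝ)
    (hP : Function.Injective P) : DrawingStory S where
  drawing t := Drawing.straightLine (S.graphAt t) (fun v => P v)
    (hP.comp Subtype.val_injective)
  pos_eq _ _ _ _ _ := rfl
  arc_eq _ _ _ _ _ _ _ _ _ := rfl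

theorem DrawingStory.straightLine_isPlanarStraightLineGrid {V : Type} [Fintype V]
    {S : GraphStory V} {P : V → ℝ × ℝ} {hP : Function.Injective P}
    (h : ∀ u v u' v', S.graph.Adj u v → S.graph.Adj u' v' → s(u, v) ≠ s(u', v') →
      ∀ z ∈ segment ℝ (P u) (P v), z ∈ segment ℝ (P u') (P v') →
        ∃ x, P x = z ∧ (x = u ∨ x = v) ∧ (x = u' ∨ x = v'))
    (hint : ∀ v, ∃ x y : ℤ, P v = ((x : ℝ), (y : ℝ))) :
    (DrawingStory.straightLine S P hP).IsPlanarStraightLineGrid := by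
  intro t
  refine ⟨Drawing.straightLine_isPlanar ?_, fun _ _ _ => rfl, fun v => hint v⟩
  rintro u v u' v' ha ha' hne z hz hz'
  obtain ⟨x, hx, hx1, hx2⟩ := h u v u' v' ha ha' (fun he => hne (by
    apply Sym2.map.injective Subtype.val_injective
    simpa using he)) z hz hz'
  have hxt : x ∈ S.present t := by
    rcases hx1 with rfl | rfl
    exacts [u.2, v.2]
  exact ⟨⟨x, hxt⟩, hx, by simpa [Subtype.ext_iff] using hx1, by simpa [Subtype.ext_iff] using hx2⟩

/-! ### The concentric drawing -/

/-- The vector `∑ c, f c • d c`, where `d 0 = (1, 0)`, `d 1 = (0, 1)` and `d 2 = (-1, -1)`. -/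
def tripod (f : Fin 3 → ℝ) : ℝ × ℝ := (f 0 - f 2, f 1 - f 2)

/-- The three directions sum to zero, so `f` and `g` differ by a constant, which nonnegativity and a
zero in each force to vanish. Crossings can thus be studied in weights instead of points. -/
theorem tripod_injective {f g : Fin 3 → ℝ} (hf : ∀ c, 0 ≤ f c) (hg : ∀ c, 0 ≤ g c)
    (hf0 : ∃ c, f c = 0) (hg0 : ∃ c, g c = 0) (h : tripod f = tripod g) : f = g := by
  have h1 : f 0 - f 2 = g 0 - g 2 := congrArg Prod.fst h
  have h2 : f 1 - f 2 = g 1 - g 2 := congrArg Prod.snd h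
  have hd : ∀ c, f c - g c = f 2 - g 2 := by
    intro c
    fin_cases c <;> simp <;> linarith
  obtain ⟨c, hc⟩ := hf0
  obtain ⟨d, hd'⟩ := hg0
  have := hd c
  have := hd d
  have := hg c
  have := hf d
  funext e
  have := hd e
  linarith

/-- The weights of the vertex `k` in the concentric drawing of the nested triangles. -/
def weight (k : ℕ) : Fin 3 → ℝ := fun c => if (c : ℕ) = k % 3 then ((k / 3 + 1 : ℕ) : ℝ) else 0

/-- The concentric drawing of the nested triangles. -/
def concentric (k : ℕ) : ℝ × ℝ := tripod (weight k)

theorem weight_nonneg (k : ℕ) (c : Fin 3) : 0 ≤ weight k c := by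
  unfold weight
  split_ifs <;> positivity

theorem weight_of_ne {k : ℕ} {c : Fin 3} (h : (c : ℕ) ≠ k % 3) : weight k c = 0 := if_neg h

theorem sum_weight (k : ℕ) : ∑ c, weight k c = ((k / 3 + 1 : ℕ) : ℝ) := by
  have hk : k % 3 < 3 := Nat.mod_lt _ (by norm_num)
  rw [Finset.sum_eq_single (⟨k % 3, hk⟩ : Fin 3)]
  · simp [weight]
  · intro c _ hc
    exact weight_of_ne fun h => hc (Fin.ext h)
  · simp

theorem eq_weight {f : Fin 3 → ℝ} {k : ℕ} (h0 : ∀ c : Fin 3, (c : ℕ) ≠ k % 3 → f c = 0)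
    (h1 : ∑ c, f c = ((k / 3 + 1 : ℕ) : ℝ)) : f = weight k := by
  have hk : k % 3 < 3 := Nat.mod_lt _ (by norm_num)
  have h2 : ∑ c, f c = f ⟨k % 3, hk⟩ :=
    Finset.sum_eq_single _ (fun c _ hc => h0 c fun h => hc (Fin.ext h)) (by simp)
  funext c
  by_cases hc : (c : ℕ) = k % 3
  · obtain rfl : c = ⟨k % 3, hk⟩ := Fin.ext hc
    rw [← h2, h1]
    simp [weight]
  · rw [h0 c hc, weight_of_ne hc]

theorem concentric_injective : Function.Injective concentric := by
  intro k l h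
  have h0 : ∀ k, ∃ c, weight k c = 0 := by
    intro k
    by_cases hk : k % 3 = 0
    · exact ⟨1, weight_of_ne (by simp [hk])⟩
    · exact ⟨0, weight_of_ne (by simpa using Ne.symm hk)⟩
  have hw := tripod_injective (weight_nonneg k) (weight_nonneg l) (h0 k) (h0 l) h
  have h1 := sum_weight k
  rw [hw, sum_weight l] at h1
  have h2 : l / 3 + 1 = k / 3 + 1 := by exact_mod_cast h1
  have hk : k % 3 < 3 := Nat.mod_lt _ (by norm_num)
  have h3 : k % 3 = l % 3 := by
    by_contra hne
    have e : weight k ⟨k % 3, hk⟩ = 0 := by rw [hw]; exact weight_of_ne hne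
    simp only [weight, if_true] at e
    norm_cast at e
  omega

theorem concentric_int (k : ℕ) : ∃ x y : ℤ, concentric k = ((x : ℝ), (y : ℝ)) := by
  set g : Fin 3 → ℤ := fun c => if (c : ℕ) = k % 3 then ((k / 3 + 1 : ℕ) : ℤ) else 0 with hg
  have : ∀ c, weight k c = g c := by
    intro c
    simp only [hg, weight]
    split_ifs
    · rw [Int.cast_natCast]
    · rw [Int.cast_zero]
  refine ⟨g 0 - g 2, g 1 - g 2, ?_⟩
  simp only [concentric, tripod, this]
  push_cast
  rfl

/-- The points of a side of a triangle. -/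
structure IsSidePoint (f : Fin 3 → ℝ) (u v : ℕ) : Prop where
  nonneg : ∀ c, 0 ≤ f c
  sum_eq : ∑ c, f c = ((u / 3 + 1 : ℕ) : ℝ)
  eq_zero : ∀ c : Fin 3, (c : ℕ) ≠ u % 3 → (c : ℕ) ≠ v % 3 → f c = 0

/-- The points of a spoke from `u` to `u + 3`. -/
structure IsSpokePoint (f : Fin 3 → ℝ) (u : ℕ) : Prop where
  nonneg : ∀ c, 0 ≤ f c
  le_sum : ((u / 3 + 1 : ℕ) : ℝ) ≤ ∑ c, f c
  sum_le : ∑ c, f c ≤ ((u / 3 + 2 : ℕ) : ℝ)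
  eq_zero : ∀ c : Fin 3, (c : ℕ) ≠ u % 3 → f c = 0

theorem exists_of_mem_segment {u v : ℕ} {z : ℝ × ℝ}
    (hz : z ∈ segment ℝ (concentric u) (concentric v)) :
    ∃ f : Fin 3 → ℝ, tripod f = z ∧ (u / 3 = v / 3 → IsSidePoint f u v) ∧
      (u + 3 = v → IsSpokePoint f u) := by
  obtain ⟨a, b, ha, hb, hab, rfl⟩ := hz
  have hn : ∀ c, 0 ≤ a * weight u c + b * weight v c := fun c => by
    have := weight_nonneg u c
    have := weight_nonneg v c
    positivity
  have hsum : ∑ c, (a * weight u c + b * weight v c)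
      = a * ((u / 3 + 1 : ℕ) : ℝ) + b * ((v / 3 + 1 : ℕ) : ℝ) := by
    rw [Finset.sum_add_distrib, ← Finset.mul_sum, ← Finset.mul_sum, sum_weight, sum_weight]
  refine ⟨fun c => a * weight u c + b * weight v c, ?_, fun h => ⟨hn, ?_, fun c hu hv => ?_⟩,
    fun h => ⟨hn, ?_, ?_, fun c hu => ?_⟩⟩
  · simp only [concentric, tripod, Prod.smul_mk, Prod.mk_add_mk, smul_eq_mul]
    ext <;> simp only <;> ring
  · rw [hsum, ← h, ← add_mul, hab, one_mul]
  · rw [weight_of_ne hu, weight_of_ne hv]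
    ring
  · rw [hsum, show v / 3 + 1 = u / 3 + 1 + 1 by omega]
    obtain rfl : a = 1 - b := by linarith
    push_cast
    linarith
  · rw [hsum, show v / 3 + 1 = u / 3 + 1 + 1 by omega]
    obtain rfl : a = 1 - b := by linarith
    push_cast
    linarith
  · rw [weight_of_ne hu, weight_of_ne (by omega)]
    ring

theorem exists_third (u v : ℕ) : ∃ c : Fin 3, (c : ℕ) ≠ u % 3 ∧ (c : ℕ) ≠ v % 3 := by
  by_cases h0 : 0 ≠ u % 3 ∧ 0 ≠ v % 3
  · exact ⟨0, h0⟩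
  by_cases h1 : 1 ≠ u % 3 ∧ 1 ≠ v % 3
  · exact ⟨1, h1⟩
  · exact ⟨2, by show 2 ≠ _ ∧ 2 ≠ _; omega⟩

/-- Equal weight sums put both sides on one triangle. Distinct sides share one vertex, and their
vanishing weights leave only its direction. -/
theorem IsSidePoint.inter_side {f : Fin 3 → ℝ} {u v u' v' : ℕ} (h : IsSidePoint f u v)
    (h' : IsSidePoint f u' v') (huv : u / 3 = v / 3) (huv' : u' / 3 = v' / 3) (hlt : u < v)
    (hlt' : u' < v') (hne : ¬ (u = u' ∧ v = v')) :
    ∃ x, f = weight x ∧ (x = u ∨ x = v) ∧ (x = u' ∨ x = v') := by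
  have hl : u / 3 + 1 = u' / 3 + 1 := by
    have := h.sum_eq.symm.trans h'.sum_eq
    exact_mod_cast this
  obtain ⟨x, hx1, hx2⟩ : ∃ x, (x = u ∨ x = v) ∧ (x = u' ∨ x = v') := by
    by_contra! hc
    have := hc u (Or.inl rfl)
    have := hc v (Or.inr rfl)
    omega
  refine ⟨x, eq_weight (fun c hc => ?_) ?_, hx1, hx2⟩
  · have := c.2
    by_cases hc1 : (c : ℕ) ≠ u % 3 ∧ (c : ℕ) ≠ v % 3
    · exact h.eq_zero c hc1.1 hc1.2
    · exact h'.eq_zero c (by omega) (by omega)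
  · rw [h.sum_eq, show u / 3 = x / 3 by omega]

/-- The spoke leaves one nonzero direction and the side fixes the sum, so the point is a vertex; the
side must contain it, or its weight would vanish. -/
theorem IsSidePoint.inter_spoke {f : Fin 3 → ℝ} {u v u' : ℕ} (h : IsSidePoint f u v)
    (h' : IsSpokePoint f u') (huv : u / 3 = v / 3) :
    ∃ x, f = weight x ∧ (x = u ∨ x = v) ∧ (x = u' ∨ x = u' + 3) := by
  have h1 : u' / 3 + 1 ≤ u / 3 + 1 := by
    have := h'.le_sum.trans_eq h.sum_eq
    exact_mod_cast this
  have h2 : u / 3 + 1 ≤ u' / 3 + 2 := by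
    have := h.sum_eq.symm.trans_le h'.sum_le
    exact_mod_cast this
  have hw : f = weight (3 * (u / 3) + u' % 3) := by
    refine eq_weight (fun c hc => h'.eq_zero c (by omega)) ?_
    rw [h.sum_eq, show (3 * (u / 3) + u' % 3) / 3 = u / 3 by omega]
  refine ⟨_, hw, ?_, by omega⟩
  by_contra hc
  have hk : u' % 3 < 3 := Nat.mod_lt _ (by norm_num)
  have e := h.eq_zero ⟨u' % 3, hk⟩ (by simp only; omega) (by simp only; omega)
  rw [hw] at e
  simp only [weight, show (3 * (u / 3) + u' % 3) % 3 = u' % 3 by omega, if_true] at e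
  norm_cast at e

/-- Spokes in different directions could only meet at the origin, where the weight sum is too small;
in the same direction, only consecutive spokes meet, at one level. -/
theorem IsSpokePoint.inter_spoke {f : Fin 3 → ℝ} {u u' : ℕ} (h : IsSpokePoint f u)
    (h' : IsSpokePoint f u') (hne : u ≠ u') :
    ∃ x, f = weight x ∧ (x = u ∨ x = u + 3) ∧ (x = u' ∨ x = u' + 3) := by
  have hc : u % 3 = u' % 3 := by
    by_contra hc
    have h0 : ∀ c, f c = 0 := by
      intro c
      by_cases hcu : (c : ℕ) = u % 3
      · exact h'.eq_zero c (by omega)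
      · exact h.eq_zero c hcu
    have := h.le_sum
    simp only [h0, Finset.sum_const_zero] at this
    norm_cast at this
  have h1 : u / 3 + 1 ≤ u' / 3 + 2 := by
    have := h.le_sum.trans h'.sum_le
    exact_mod_cast this
  have h2 : u' / 3 + 1 ≤ u / 3 + 2 := by
    have := h'.le_sum.trans h.sum_le
    exact_mod_cast this
  rcases lt_or_gt_of_ne hne with hlt | hlt
  · obtain rfl : u' = u + 3 := by omega
    refine ⟨u + 3, eq_weight (fun c hc => h'.eq_zero c hc) (le_antisymm ?_ h'.le_sum), by simp,
      by simp⟩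
    rw [show (u + 3) / 3 + 1 = u / 3 + 2 by omega]
    exact h.sum_le
  · obtain rfl : u = u' + 3 := by omega
    refine ⟨u' + 3, eq_weight (fun c hc => h.eq_zero c hc) (le_antisymm ?_ h.le_sum), by simp,
      by simp⟩
    rw [show (u' + 3) / 3 + 1 = u' / 3 + 2 by omega]
    exact h'.sum_le

theorem concentric_inter_of_lt {u v u' v' : ℕ} (ha : NestedAdj u v) (ha' : NestedAdj u' v')
    (hlt : u < v) (hlt' : u' < v') (hne : ¬ (u = u' ∧ v = v')) {z : ℝ × ℝ}
    (hz : z ∈ segment ℝ (concentric u) (concentric v))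
    (hz' : z ∈ segment ℝ (concentric u') (concentric v')) :
    ∃ x, concentric x = z ∧ (x = u ∨ x = v) ∧ (x = u' ∨ x = v') := by
  obtain ⟨f, hf, hside, hspoke⟩ := exists_of_mem_segment hz
  obtain ⟨f', hf', hside', hspoke'⟩ := exists_of_mem_segment hz'
  have key : ∀ u v : ℕ, ∀ f : Fin 3 → ℝ, NestedAdj u v → u < v →
      (u / 3 = v / 3 → IsSidePoint f u v) → (u + 3 = v → IsSpokePoint f u) →
      (∀ c, 0 ≤ f c) ∧ ∃ c, f c = 0 := by
    intro u v f ha hlt h1 h2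
    -- An edge uses at most two of the three directions, which supplies the zero weight needed for
    -- uniqueness.
    obtain ⟨c, hc, hc'⟩ := exists_third u v
    rcases ha.2 with h | h | h
    · exact ⟨(h1 h).nonneg, c, (h1 h).eq_zero c hc hc'⟩
    · exact ⟨(h2 h).nonneg, c, (h2 h).eq_zero c hc⟩
    · omega
  have k := key u v f ha hlt hside hspoke
  have k' := key u' v' f' ha' hlt' hside' hspoke'
  obtain rfl : f = f' := tripod_injective k.1 k'.1 k.2 k'.2 (hf.trans hf'.symm)
  obtain ⟨x, hx, hx1, hx2⟩ : ∃ x, f = weight x ∧ (x = u ∨ x = v) ∧ (x = u' ∨ x = v') := by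
    rcases ha.2 with h | h | h
    · rcases ha'.2 with h' | h' | h'
      · exact (hside h).inter_side (hside' h') h h' hlt hlt' hne
      · exact h' ▸ (hside h).inter_spoke (hspoke' h') h
      · omega
    · rcases ha'.2 with h' | h' | h'
      · obtain ⟨x, hx, hx1, hx2⟩ := (hside' h').inter_spoke (hspoke h) h'
        exact ⟨x, hx, h ▸ hx2, hx1⟩
      · exact h ▸ h' ▸ (hspoke h).inter_spoke (hspoke' h') (by omega)
      · omega
    · omega
  exact ⟨x, by rw [concentric, ← hx, hf], hx1, hx2⟩

theorem concentric_inter {u v u' v' : ℕ} (ha : NestedAdj u v) (ha' : NestedAdj u' v')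
    (hne : ¬ (u = u' ∧ v = v' ∨ u = v' ∧ v = u')) {z : ℝ × ℝ}
    (hz : z ∈ segment ℝ (concentric u) (concentric v))
    (hz' : z ∈ segment ℝ (concentric u') (concentric v')) :
    ∃ x, concentric x = z ∧ (x = u ∨ x = v) ∧ (x = u' ∨ x = v') := by
  have swap : ∀ {u v}, NestedAdj u v → NestedAdj v u := fun h => ⟨h.1.symm, by have := h.2; omega⟩
  rcases lt_or_gt_of_ne ha.1 with hlt | hlt <;> rcases lt_or_gt_of_ne ha'.1 with hlt' | hlt'
  · exact concentric_inter_of_lt ha ha' hlt hlt' (by omega) hz hz'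
  · rw [segment_symm] at hz'
    obtain ⟨x, hx, h1, h2⟩ :=
      concentric_inter_of_lt ha (swap ha') hlt hlt' (by omega) hz hz'
    exact ⟨x, hx, h1, h2.symm⟩
  · rw [segment_symm] at hz
    obtain ⟨x, hx, h1, h2⟩ :=
      concentric_inter_of_lt (swap ha) ha' hlt hlt' (by omega) hz hz'
    exact ⟨x, hx, h1.symm, h2⟩
  · rw [segment_symm] at hz hz'
    obtain ⟨x, hx, h1, h2⟩ :=
      concentric_inter_of_lt (swap ha) (swap ha') hlt hlt' (by omega) hz hz'
    exact ⟨x, hx, h1.symm, h2.symm⟩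

theorem nestedTriangles_inter {n : ℕ} {u v u' v' : Fin n} (ha : (nestedTriangles n).Adj u v)
    (ha' : (nestedTriangles n).Adj u' v') (hne : s(u, v) ≠ s(u', v')) {z : ℝ × ℝ}
    (hz : z ∈ segment ℝ (concentric u) (concentric v))
    (hz' : z ∈ segment ℝ (concentric u') (concentric v')) :
    ∃ x : Fin n, concentric x = z ∧ (x = u ∨ x = v) ∧ (x = u' ∨ x = v') := by
  obtain ⟨x, hx, hx1, hx2⟩ := concentric_inter (nestedTriangles_adj.1 ha)
    (nestedTriangles_adj.1 ha') (by
      rw [Ne, Sym2.eq_iff] at hne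
      simpa [Fin.ext_iff] using hne) hz hz'
  refine ⟨⟨x, ?_⟩, hx, by simpa [Fin.ext_iff] using hx1, by simpa [Fin.ext_iff] using hx2⟩
  rcases hx1 with rfl | rfl
  exacts [u.2, v.2]

theorem nestedTrianglesStory_isPlanar (n : ℕ) : (nestedTrianglesStory n).IsPlanar :=
  ⟨Drawing.straightLine _ (fun v => concentric v)
      (concentric_injective.comp Fin.val_injective),
    Drawing.straightLine_isPlanar fun _ _ _ _ ha ha' hne _ hz hz' =>
      nestedTriangles_inter ha ha' hne hz hz'⟩

theorem exists_isPlanarStraightLineGrid (n : ℕ) :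
    ∃ Γ : DrawingStory (nestedTrianglesStory n), Γ.IsPlanarStraightLineGrid :=
  ⟨DrawingStory.straightLine _ (fun v => concentric v)
      (concentric_injective.comp Fin.val_injective),
    DrawingStory.straightLine_isPlanarStraightLineGrid
      (fun _ _ _ _ ha ha' hne _ hz hz' => nestedTriangles_inter ha ha' hne hz hz')
      fun v => concentric_int v⟩

/-! ### The theorem -/

theorem theorem1 :
    -- the nested triangles story is a planar graph story, and each planar straight-line grid
    -- drawing story of it needs an `Ω(n) × Ω(n)` grid
    (∃ c : ℝ, 0 < c ∧ ∀ n : ℕ, 3 ∣ n →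
      (nestedTrianglesStory n).IsPlanar ∧
      ∀ Γ : DrawingStory (nestedTrianglesStory n), Γ.IsPlanarStraightLineGrid →
        ∀ w h : ℕ, Γ.LiesOn w h → c * (n : ℝ) ≤ (w : ℝ) ∧ c * (n : ℝ) ≤ (h : ℝ)) ∧
    -- no function of the window size bounds the area for all planar graph stories
    (∀ f : ℕ → ℕ, ∃ (V : Type) (_ : Fintype V) (S : GraphStory V), S.IsPlanar ∧
      (∃ Γ : DrawingStory S, Γ.IsPlanarStraightLineGrid) ∧
      ∀ Γ : DrawingStory S, Γ.IsPlanarStraightLineGrid →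
        ∃ t : S.Time, ∀ w h : ℕ, (Γ.drawing t).LiesOn w h → f S.W < w * h) := by
  -- With `n = 3 * m`, both dimensions are at least `m / 2 = n / 6`.
  refine ⟨⟨1 / 6, by norm_num, fun n hn => ⟨nestedTrianglesStory_isPlanar n, ?_⟩⟩, fun f => ?_⟩
  · obtain ⟨m, rfl⟩ := hn
    intro Γ hΓ w h hwh
    rcases Nat.eq_zero_or_pos m with rfl | hm
    · simp
    obtain ⟨t, ht⟩ := exists_large_drawing hm Γ hΓ
    obtain ⟨h1, h2⟩ := ht w h (hwh t)
    have h1' : (m : ℝ) ≤ 2 * w := by exact_mod_cast h1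
    have h2' : (m : ℝ) ≤ 2 * h := by exact_mod_cast h2
    push_cast
    constructor <;> linarith
  -- Taking `m = 2 * (f 9 + 1)` makes both dimensions at least `f 9 + 1`.
  · refine ⟨_, _, nestedTrianglesStory (3 * (2 * (f 9 + 1))), nestedTrianglesStory_isPlanar _,
      exists_isPlanarStraightLineGrid _, fun Γ hΓ => ?_⟩
    obtain ⟨t, ht⟩ := exists_large_drawing (by omega) Γ hΓ
    refine ⟨t, fun w h hwh => ?_⟩
    obtain ⟨h1, h2⟩ := ht w h hwh
    calc f 9 < f 9 + 1 := Nat.lt_succ_self _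
      _ ≤ (f 9 + 1) * (f 9 + 1) := Nat.le_mul_self _
      _ ≤ w * h := Nat.mul_le_mul (by omega) (by omega)
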